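/- For $\theta\in\mathbb R$ let $H(\theta)=\{re^{i(\theta+\phi)} : r>0,\ -\pi/2<\phi<\pi/2\}$. Let $n\ge 2$ and let $\omega_1,\dots,\omega_n\in H(\theta)$ for some $\theta\in\mathbb R$, with $\operatorname{Im}(\omega_j/\omega_k)\neq 0$ whenever $j\neq k$. Put $a(0)=\omega_1+\cdots+\omega_n$, and let $\zeta_n(s,a(0);\omega_1,\dots,\omega_n)$ be the Barnes zeta-function, i.e. the meromorphic continuation to $s\in\mathbb C$ of $$\sum_{m_1=0}^\infty\cdots\sum_{m_n=0}^\infty\frac{1}{(a(0)+\omega_1m_1+\cdots+\omega_nm_n)^{s}}\qquad(\operatorname{Re}s>n),$$ where the arguments of the bases are taken in $(\theta-\pi/2,\theta+\pi/2)$; this series converges absolutely for $\operatorname{Re}s>n$, and the continuation exists. For $1\le k\le n$ let $$I_k^{\pm}=\{j\in\{1,\dots,n\}\setminus\{k\} : \pm\operatorname{Im}(\omega_j/\omega_k)>0\},$$ and for $J\subset\{1,\dots,n\}$ let $\delta(J)=0$ if $J\ne\emptyset$ and $\delta(\emptyset)=(-1)^{n+1}$. Then $$\begin{aligned} \zeta_n(s,a(0);\omega_1,\dots,\omega_n)=-\frac{2\pi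 i}{\Gamma(s)(e^{2\pi is}-1)}\sum_{k=1}^n\omega_k^{-1}\Biggl\{&\sum_{m>0}(2m\pi i\,\omega_k^{-1})^{s-1}\biggl(\Bigl(\prod_{j\ne k}\frac{1}{e^{2m\pi i\omega_j/\omega_k}-1}\Bigr)-\delta(I_k^-)\biggr)\\ &+\sum_{m>0}(-2m\pi i\,\omega_k^{-1})^{s-1}\biggl(\Bigl(\prod_{j\ne k}\frac{1}{e^{-2m\pi i\omega_j/\omega_k}-1}\Bigr)-\delta(I_k^+)\biggr)\\ &+\delta(I_k^-)(2\pi i\,\omega_k^{-1})^{s-1}\zeta(1-s)+\delta(I_k^+)(-2\pi i\,\omega_k^{-1})^{s-1}\zeta(1-s)\Biggr\}, \end{aligned}$$ where $\zeta$ is the Riemann zeta-function and the arguments of $\pm2m\pi i\,\omega_k^{-1}$ and $\pm2\pi i\,\omega_k^{-1}$ in the powers are taken in $(-\theta,-\theta+2\pi)$. This is an identity of meromorphic functions of $s$ on $\mathbb C$; in particular it holds at every $s\in\mathbb C\setminus\mathbb Z$. The series over $m>0$ on the right-hand side converge absolutely and uniformly on every compact subset of $\mathbb C$. -/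

import Mathlib

open Complex Finset Topology

noncomputable section

namespace BarnesZeta

/-- The open half plane `H(θ) = {r e^{i(θ+φ)} : r > 0, -π/2 < φ < π/2}` with normal vector
`e^{iθ}`. -/
def halfPlane (θ : ℝ) : Set ℂ :=
  {z | ∃ r φ : ℝ, 0 < r ∧ -(Real.pi / 2) < φ ∧ φ < Real.pi / 2 ∧
    z = (r : ℂ) * exp (((θ + φ : ℝ) : ℂ) * I)}

/-- The logarithm of `z ≠ 0` whose imaginary part (the argument of `z`) lies in `(c - π, c + π]`. -/
def logAround (c : ℝ) (z : ℂ) : ℂ :=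
  log (z * exp (-((c : ℂ) * I))) + (c : ℂ) * I

/-- The power `z ^ s` (for `z ≠ 0`), the argument of `z` being taken in `(c - π, c + π]`. -/
def cpowAround (c : ℝ) (z s : ℂ) : ℂ :=
  exp (s * logAround c z)

/-- The term `(a + ω₁ m₁ + ⋯ + ωₙ mₙ) ^ (-s)` of the multiple Dirichlet series of Barnes.
For `a` and all `ω j` in `H(θ)` the base lies in `H(θ)`, and the power is formed with the argument
of the base in `(θ - π/2, θ + π/2)`. -/
def dirichletTerm {n : ℕ} (θ : ℝ) (a : ℂ) (ω : Fin n → ℂ) (s : ℂ) (m : Fin n → ℕ) : ℂ :=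
  cpowAround θ (a + ∑ j, ω j * (m j : ℂ)) (-s)

/-- `Z` is the meromorphic continuation to `ℂ` of the multiple Dirichlet series: it is meromorphic
on `ℂ`, and on `Re s > n` the series converges (absolutely) to it. Normal form means that `Z` is
analytic wherever it has no pole, and is given the default value `0` at its poles; so there is at
most one such `Z`. -/
def IsBarnesZeta {n : ℕ} (θ : ℝ) (a : ℂ) (ω : Fin n → ℂ) (Z : ℂ → ℂ) : Prop :=
  MeromorphicNFOn Z Set.univ ∧
    ∀ s : ℂ, (n : ℝ) < s.re → HasSum (dirichletTerm θ a ω s) (Z s)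

open Classical in
/-- The Barnes zeta-function `ζ_n(s, a; ω₁, …, ωₙ)` as a meromorphic function of `s ∈ ℂ`. -/
def barnesZeta {n : ℕ} (θ : ℝ) (a : ℂ) (ω : Fin n → ℂ) : ℂ → ℂ :=
  if h : ∃ Z, IsBarnesZeta θ a ω Z then h.choose else 0

/-- The point `a(y₁, …, yₙ) = ω₁ (1 - y₁) + ⋯ + ωₙ (1 - yₙ)` for `y₁ = ⋯ = yₙ = y`. -/
def aPoint {n : ℕ} (ω : Fin n → ℂ) (y : ℝ) : ℂ :=
  ∑ j, ω j * (1 - (y : ℂ))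

/-- `I_k⁺ = {j ≠ k : Im (ω_j / ω_k) > 0}`. -/
def indexPos {n : ℕ} (ω : Fin n → ℂ) (k : Fin n) : Set (Fin n) :=
  {j | j ≠ k ∧ 0 < (ω j / ω k).im}

/-- `I_k⁻ = {j ≠ k : Im (ω_j / ω_k) < 0}`. -/
def indexNeg {n : ℕ} (ω : Fin n → ℂ) (k : Fin n) : Set (Fin n) :=
  {j | j ≠ k ∧ (ω j / ω k).im < 0}

open Classical in
/-- `δ(J) = 0` if `J ≠ ∅`, and `δ(∅) = (-1) ^ (n + 1)`. -/
def delta {n : ℕ} (J : Set (Fin n)) : ℂ :=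
  if J = ∅ then (-1) ^ (n + 1) else 0

/-- The power `t ^ s` with `-θ < arg t ≤ -θ + 2π`. -/
def tPow (θ : ℝ) (t s : ℂ) : ℂ :=
  cpowAround (-θ + Real.pi) t s

/-- The term of index `m > 0` of the first series attached to `k`:
`(2mπi/ω_k)^(s-1) (∏_{j≠k} 1/(e^{2mπi ω_j/ω_k} - 1) - δ(I_k⁻))`. -/
def termPos {n : ℕ} (θ : ℝ) (ω : Fin n → ℂ) (k : Fin n) (m : ℕ+) (s : ℂ) : ℂ :=
  tPow θ (2 * (m : ℂ) * Real.pi * I * (ω k)⁻¹) (s - 1) *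
    ((∏ j ∈ univ.erase k, 1 / (exp (2 * (m : ℂ) * Real.pi * I * ω j / ω k) - 1)) -
      delta (indexNeg ω k))

/-- The term of index `m > 0` of the second series attached to `k`:
`(-2mπi/ω_k)^(s-1) (∏_{j≠k} 1/(e^{-2mπi ω_j/ω_k} - 1) - δ(I_k⁺))`. -/
def termNeg {n : ℕ} (θ : ℝ) (ω : Fin n → ℂ) (k : Fin n) (m : ℕ+) (s : ℂ) : ℂ :=
  tPow θ (-2 * (m : ℂ) * Real.pi * I * (ω k)⁻¹) (s - 1) *
    ((∏ j ∈ univ.erase k, 1 / (exp (-2 * (m : ℂ) * Real.pi * I * ω j / ω k) - 1)) -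
      delta (indexPos ω k))

/-- The right-hand side of the functional equation of `ζ_n(s, a(0); ω)`. -/
def funcEqRHS {n : ℕ} (θ : ℝ) (ω : Fin n → ℂ) (s : ℂ) : ℂ :=
  -(2 * Real.pi * I / (Gamma s * (exp (2 * Real.pi * I * s) - 1))) *
    ∑ k, (ω k)⁻¹ *
      ((∑' m : ℕ+, termPos θ ω k m s) + (∑' m : ℕ+, termNeg θ ω k m s) +
        delta (indexNeg ω k) * tPow θ (2 * Real.pi * I * (ω k)⁻¹) (s - 1) *
          riemannZeta (1 - s) +
        delta (indexPos ω k) * tPow θ (-2 * Real.pi * I * (ω k)⁻¹) (s - 1) *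
          riemannZeta (1 - s))

/-- A series of functions converges absolutely uniformly on every compact subset of `ℂ`: the series
of the absolute values of its terms converges uniformly there. -/
def AbsUnifOnCompacts {ι : Type*} (f : ι → ℂ → ℂ) : Prop :=
  ∀ K : Set ℂ, IsCompact K → SummableUniformlyOn (fun i s => ‖f i s‖) K

end BarnesZeta

end

/-!
The classical proof writes `Γ(s) ζ_n(s, a(0))` as the Mellin transform of `∏ 1 / (e ^ (ω_j t) - 1)`
along the ray `arg t = -θ` and turns that ray once around the origin, picking up the residues at
the poles `2mπi / ω_k`. Here the rotation is carried out on the level of the lattice sum, where no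
contour integral is needed.

For an angle `x` expand each factor `1 / (e ^ (ω_j t) - 1)` in the direction in which it converges
for `arg t = -x`: as `∑_{m ≥ 1} e ^ (-mω_j t)` if `ω_j` lies in the half plane `H(x)`, and as
`-∑_{m ≤ 0} e ^ (-mω_j t)` otherwise. Up to the factor `Γ(s)`, the term by term transform is a
signed sum of `(m₁ω₁ + ⋯ + mₙωₙ) ^ (-s)` over a cone in `H(x)`, with arguments near `x`. For a fixed
lattice point `m ≠ 0` its contribution `sectorTerm` is a piecewise constant function of `x`, which
jumps only where a line `ℝ ω_k` bounds `H(x)`. Between `x = θ` and `x = θ + 2π` it is multiplied by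
`e ^ (-2πis)`, so that `(e ^ (-2πis) - 1)` times the term at `θ` is the sum of the `2n` jumps
(`exp_sub_one_mul_sectorTerm`). Summed over all `m ≠ 0`, the left-hand side becomes
`(e ^ (-2πis) - 1) ζ_n(s, a(0))`.

The jump at the line `ℝ ω_k` no longer restricts `m_k`. The sum over `m_k ∈ ℤ` is given by
Lipschitz's formula `lipschitz_formula` (Poisson summation), and the sums over the remaining `m_j`
are then geometric series. This yields the products `∏_{j ≠ k} 1 / (e ^ (± 2mπi ω_j / ω_k) - 1)`.
The line of lattice points through the origin has to be treated separately, because the origin is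
excluded; it occurs exactly when `δ ≠ 0`, and there the functional equation of `ζ` takes the place
of Lipschitz's formula (`gamma_mul_tsum_latticeCoeff`).

This proves the formula for `Re s > n`, `s ∉ ℤ` (`tsum_dirichletTerm_eq_funcEqRHS`). Since the
products without their limits decay exponentially in `m`, the right-hand side is meromorphic on `ℂ`.
So it provides the continuation, and uniqueness of the continuation gives the theorem.
-/

noncomputable section

namespace BarnesZeta

/-! ### Laplace transform of a power and Lipschitz's formula -/

open MeasureTheory Filter in
theorem integrableOn_cpow_mul_exp_neg_mul {s r : ℂ} (hs : 0 < s.re) (hr : 0 < r.re) :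
    IntegrableOn (fun t : ℝ => (t : ℂ) ^ (s - 1) * exp (-(r * t))) (Set.Ioi 0) := by
  have h := integrableOn_rpow_mul_exp_neg_mul_rpow (s := s.re - 1) (p := 1) (b := r.re)
    (by linarith) one_pos hr
  refine h.mono' (ContinuousOn.aestronglyMeasurable (fun t ht => ?_) measurableSet_Ioi) ?_
  · refine ContinuousAt.continuousWithinAt (ContinuousAt.mul ?_ (by fun_prop))
    exact continuousAt_ofReal_cpow_const _ _ (Or.inr ht.ne')
  · filter_upwards [ae_restrict_mem measurableSet_Ioi] with t ht
    rw [norm_mul, norm_cpow_eq_rpow_re_of_pos ht, norm_exp]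
    simp

open MeasureTheory Filter in
/-- The Laplace transform of `t ^ (s - 1)` on the right half plane. Mathlib has it for real `r`;
both sides are analytic in `r`. -/
theorem integral_cpow_mul_exp_neg_mul {s r : ℂ} (hs : 0 < s.re) (hr : 0 < r.re) :
    ∫ t : ℝ in Set.Ioi 0, (t : ℂ) ^ (s - 1) * exp (-(r * t)) = Gamma s * r ^ (-s) := by
  set U : Set ℂ := {z | 0 < z.re}
  have hU : IsOpen U := isOpen_lt continuous_const continuous_re
  have hconv : Convex ℝ U := convex_halfSpace_re_gt 0
  have h1 : DifferentiableOn ℂ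
      (fun r : ℂ => ∫ t : ℝ in Set.Ioi 0, (t : ℂ) ^ (s - 1) * exp (-(r * t))) U := by
    intro z hz
    have hz' : 0 < z.re := hz
    have key := hasDerivAt_integral_of_dominated_loc_of_deriv_le
      (μ := volume.restrict (Set.Ioi (0 : ℝ)))
      (F := fun (r : ℂ) (t : ℝ) => (t : ℂ) ^ (s - 1) * exp (-(r * t)))
      (F' := fun (r : ℂ) (t : ℝ) => (t : ℂ) ^ (s - 1) * (exp (-(r * t)) * (-t)))
      (x₀ := z) (s := Metric.ball z (z.re / 2))
      (bound := fun t : ℝ => ‖(t : ℂ) ^ ((s + 1) - 1) * exp (-(((z.re / 2 : ℝ) : ℂ) * t))‖)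
      (Metric.ball_mem_nhds _ (by linarith)) ?_ ?_ ?_ ?_ ?_ ?_
    · exact key.2.differentiableAt.differentiableWithinAt
    · filter_upwards [hU.mem_nhds hz] with r hr
      exact (integrableOn_cpow_mul_exp_neg_mul hs hr).aestronglyMeasurable
    · exact integrableOn_cpow_mul_exp_neg_mul hs hz
    · have := (integrableOn_cpow_mul_exp_neg_mul hs hz).aestronglyMeasurable
      refine (this.mul (g := fun t : ℝ => (-t : ℂ)) ?_).congr ?_
      · exact Continuous.aestronglyMeasurable (by fun_prop)
      · exact Eventually.of_forall fun t => by simp only [Pi.mul_apply]; ring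
    · filter_upwards [ae_restrict_mem measurableSet_Ioi] with t ht x hx
      have ht' : (0 : ℝ) < t := ht
      have hx' : z.re / 2 < x.re := by
        have h := (abs_re_le_norm (x - z)).trans_lt (mem_ball_iff_norm.mp hx)
        rw [sub_re, abs_lt] at h
        linarith [h.1]
      simp only [norm_mul, norm_cpow_eq_rpow_re_of_pos ht', norm_exp, norm_neg, norm_real,
        Real.norm_of_nonneg ht'.le]
      have e1 : t ^ ((s + 1 - 1 : ℂ).re) = t ^ ((s - 1).re) * t := by
        rw [← Real.rpow_add_one ht'.ne']; congr 1; simp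
      rw [e1, mul_assoc]
      refine mul_le_mul_of_nonneg_left ?_ (by positivity)
      rw [mul_comm]
      refine mul_le_mul_of_nonneg_left ?_ ht'.le
      apply Real.exp_le_exp.mpr
      simp only [neg_re, mul_re, ofReal_re, ofReal_im, mul_zero, sub_zero]
      nlinarith
    · exact (integrableOn_cpow_mul_exp_neg_mul (s := s + 1) (by simp; linarith)
        (by simpa using hz')).norm
    · refine Eventually.of_forall fun t x _ => ?_
      have : HasDerivAt (fun x : ℂ => exp (-(x * t))) (exp (-(x * t)) * (-t)) x := by
        have h0 : HasDerivAt (fun x : ℂ => -(x * t)) (-(1 * (t : ℂ))) x :=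
          ((hasDerivAt_id x).mul_const (t : ℂ)).neg
        simpa using h0.cexp
      exact this.const_mul _
  have h2 : DifferentiableOn ℂ (fun r : ℂ => Gamma s * r ^ (-s)) U := by
    intro z hz
    refine DifferentiableAt.differentiableWithinAt (DifferentiableAt.const_mul ?_ _)
    exact DifferentiableAt.cpow_const differentiableAt_id (Or.inl hz)
  have h3 : ∀ x : ℝ, 0 < x → ∫ t : ℝ in Set.Ioi 0, (t : ℂ) ^ (s - 1) * exp (-((x : ℂ) * t))
      = Gamma s * (x : ℂ) ^ (-s) := by
    intro x hx
    rw [integral_cpow_mul_exp_neg_mul_Ioi hs hx, mul_comm, one_div, inv_cpow, cpow_neg]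
    rw [arg_ofReal_of_nonneg hx.le]
    exact Real.pi_pos.ne
  refine (h1.analyticOnNhd hU).eqOn_of_preconnected_of_frequently_eq (h2.analyticOnNhd hU)
    hconv.isPreconnected (z₀ := 1) (by simp [U]) ?_ hr
  have hseq : Tendsto (fun n : ℕ => ((1 + 1 / ((n : ℝ) + 1) : ℝ) : ℂ)) atTop (𝓝[≠] 1) := by
    rw [tendsto_nhdsWithin_iff]
    constructor
    · have h := tendsto_one_div_add_atTop_nhds_zero_nat (𝕜 := ℝ)
      have h' := (continuous_ofReal.tendsto _).comp (h.const_add 1)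
      simpa [Function.comp_def] using h'
    · refine Eventually.of_forall fun n => ?_
      have : (0 : ℝ) < 1 / ((n : ℝ) + 1) := by positivity
      simp only [Set.mem_compl_iff, Set.mem_singleton_iff]
      rw [← ofReal_one, ofReal_inj]
      linarith
  refine hseq.frequently (Frequently.of_forall fun n => ?_)
  exact h3 _ (by positivity)

theorem norm_cpow_neg_le (w s : ℂ) :
    ‖w ^ (-s)‖ ≤ Real.exp (Real.pi * |s.im|) * ‖w‖ ^ (-s.re) := by
  refine (norm_cpow_le _ _).trans ?_
  rw [div_eq_mul_inv, ← Real.exp_neg, mul_comm, neg_re]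
  refine mul_le_mul_of_nonneg_right (Real.exp_le_exp.mpr ?_) (by positivity)
  rw [neg_im, mul_neg, neg_neg]
  calc w.arg * s.im ≤ |w.arg * s.im| := le_abs_self _
    _ = |w.arg| * |s.im| := abs_mul _ _
    _ ≤ _ := mul_le_mul_of_nonneg_right (abs_arg_le_pi _) (abs_nonneg _)

open Filter Asymptotics in
theorem summable_int_cpow_neg {s z : ℂ} (hs : 1 < s.re) (c : ℂ) (hc : c ≠ 0) :
    Summable fun m : ℤ => (c * (m + z)) ^ (-s) := by
  refine summable_of_isBigO (Real.summable_abs_int_rpow hs) ?_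
  refine IsBigO.of_bound (Real.exp (Real.pi * |s.im|) * (‖c‖ / 2) ^ (-s.re)) ?_
  have h1 : ∀ᶠ m : ℤ in cofinite, 2 * ‖z‖ + 1 ≤ |(m : ℝ)| :=
    (Int.tendsto_coe_cofinite).eventually
      ((tendsto_norm_cocompact_atTop (E := ℝ)).eventually (eventually_ge_atTop _))
  filter_upwards [h1] with m hm
  have hm0 : 0 < |(m : ℝ)| := by linarith [norm_nonneg z]
  have h2 : ‖c‖ / 2 * |(m : ℝ)| ≤ ‖c * (m + z)‖ := by
    rw [norm_mul, div_mul_eq_mul_div, mul_div_assoc]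
    refine mul_le_mul_of_nonneg_left ?_ (norm_nonneg _)
    have h3 := norm_sub_le ((m : ℂ) + z) z
    rw [add_sub_cancel_right, norm_intCast] at h3
    linarith
  have hc' := norm_pos_iff.mpr hc
  refine (norm_cpow_neg_le _ _).trans ?_
  rw [Real.norm_of_nonneg (by positivity), mul_assoc,
    ← Real.mul_rpow (by positivity) (by positivity)]
  refine mul_le_mul_of_nonneg_left ?_ (by positivity)
  exact Real.rpow_le_rpow_of_nonpos (by positivity) h2 (by linarith)

open MeasureTheory Filter Asymptotics in
/-- **Lipschitz's formula**, obtained from Poisson summation for `t ^ (s - 1) e ^ (2πizt)`. -/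
theorem lipschitz_formula {s z : ℂ} (hs : 1 < s.re) (hz : 0 < z.im) :
    Gamma s * ∑' m : ℤ, (-2 * Real.pi * I * (m + z)) ^ (-s) =
      ∑' r : ℕ+, (r : ℂ) ^ (s - 1) * exp (2 * Real.pi * I * r * z) := by
  set f : ℝ → ℂ := fun x => ((max x 0 : ℝ) : ℂ) ^ (s - 1) * exp (2 * Real.pi * I * x * z) with hf
  have hs1 : s - 1 ≠ 0 := fun h => by
    have := congrArg re h
    simp at this; linarith
  have hf0 : ∀ x ≤ 0, f x = 0 := fun x hx => by
    simp [hf, max_eq_right hx, zero_cpow hs1]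
  have hfpos : ∀ x : ℝ, 0 < x → f x = (x : ℂ) ^ (s - 1) * exp (2 * Real.pi * I * x * z) :=
    fun x hx => by simp only [hf, max_eq_left hx.le]
  -- Continuity at `0` is where `Re s > 1` is needed: it makes `0` the limit of `x ^ (s - 1)`.
  have hcont : Continuous f := by
    refine Continuous.mul ?_ (by fun_prop)
    exact (continuous_ofReal_cpow_const (by simpa using hs)).comp
      (by fun_prop : Continuous fun x : ℝ => max x 0)
  have hdecay : f =O[cocompact ℝ] fun x : ℝ => |x| ^ (-2 : ℝ) := by
    rw [cocompact_eq_atBot_atTop, isBigO_sup]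
    constructor
    · refine IsBigO.of_bound 1 ?_
      filter_upwards [eventually_le_atBot 0] with x hx
      rw [hf0 x hx, norm_zero]; positivity
    · have h1 := isLittleO_exp_neg_mul_rpow_atTop (a := 2 * Real.pi * z.im) (by positivity)
        (-2 - (s.re - 1))
      refine IsBigO.trans ?_
        ((isBigO_refl (fun x : ℝ => x ^ (s.re - 1)) atTop).mul h1.isBigO |>.trans ?_)
      · refine IsBigO.of_bound 1 ?_
        filter_upwards [eventually_gt_atTop 0] with x hx
        rw [hfpos x hx, norm_mul, norm_cpow_eq_rpow_re_of_pos hx, norm_exp, one_mul, norm_mul,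
          Real.norm_of_nonneg (by positivity), Real.norm_of_nonneg (Real.exp_pos _).le]
        simp only [sub_re, one_re]
        refine le_of_eq (congrArg _ (congrArg _ ?_))
        simp
        ring
      · refine IsBigO.of_bound 1 ?_
        filter_upwards [eventually_gt_atTop 0] with x hx
        rw [← Real.rpow_add hx, abs_of_pos hx, one_mul]
        refine le_of_eq (congrArg _ (congrArg _ ?_))
        ring
  have hF : ∀ w : ℝ, FourierTransform.fourier f w =
      Gamma s * (-2 * Real.pi * I * (((-w : ℝ) : ℂ) + z)) ^ (-s) := by
    intro w
    rw [Real.fourier_real_eq_integral_exp_smul, ← integral_cpow_mul_exp_neg_mul (by linarith)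
      (by simp; positivity)]
    have hsupp : Function.support (fun v : ℝ => exp (((-2 * Real.pi * v * w : ℝ) : ℂ) * I) • f v)
        ⊆ Set.Ioi 0 := by
      intro v hv
      by_contra h
      exact hv (by simp [hf0 v (not_lt.mp h)])
    rw [← setIntegral_eq_integral_of_forall_compl_eq_zero (s := Set.Ioi 0)
      (fun x hx => by
        by_contra h
        exact hx (hsupp h))]
    refine setIntegral_congr_fun measurableSet_Ioi fun v hv => ?_
    rw [hfpos v hv, smul_eq_mul, mul_left_comm, ← exp_add]
    congr 2
    push_cast
    ring
  have hsumm : Summable fun m : ℤ => (-2 * Real.pi * I * (m + z)) ^ (-s) :=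
    summable_int_cpow_neg hs _ (by simp [Real.pi_ne_zero])
  have hFneg : ∀ m : ℤ, FourierTransform.fourier f (m : ℝ) =
      Gamma s * (-2 * Real.pi * I * ((Equiv.neg ℤ m : ℤ) + z)) ^ (-s) := by
    intro m; rw [hF]; simp
  have hP := Real.tsum_eq_tsum_fourier_of_rpow_decay_of_summable hcont one_lt_two hdecay
    (by
      simp_rw [hFneg]
      exact ((Equiv.neg ℤ).summable_iff (f := fun m : ℤ => (-2 * Real.pi * I * (m + z)) ^ (-s))).mpr
        hsumm |>.mul_left _) 0
  simp only [zero_add, hFneg, QuotientAddGroup.mk_zero, fourier_eval_zero, mul_one] at hP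
  rw [tsum_mul_left, (Equiv.neg ℤ).tsum_eq (fun m : ℤ => (-2 * Real.pi * I * (m + z)) ^ (-s))] at hP
  rw [← hP]
  have hinj : Function.Injective (fun r : ℕ+ => ((r : ℕ) : ℤ)) := fun a b h => by
    simpa using h
  rw [← hinj.tsum_eq (f := fun m : ℤ => f m)]
  · refine tsum_congr fun r => ?_
    rw [hfpos _ (by simp)]
    simp
  · intro m hm
    have : 0 < m := by
      by_contra h
      exact hm (hf0 _ (by exact_mod_cast not_lt.mp h))
    exact ⟨⟨m.toNat, by omega⟩, by simp; omega⟩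

/-! ### Multiple sums and the expansion coefficients -/

/-- Fubini for a product of finitely many absolutely convergent series over `ℤ`. -/
theorem summable_norm_prod_pi {ι R : Type*} [Fintype ι] [NormedCommRing R] [CompleteSpace R] :
    ∀ f : ι → ℤ → R, (∀ i, Summable fun k => ‖f i k‖) →
      (Summable fun m : ι → ℤ => ‖∏ i, f i (m i)‖) ∧
        ∑' m : ι → ℤ, ∏ i, f i (m i) = ∏ i, ∑' k, f i k := by
  apply Fintype.induction_empty_option (P := fun ι _ => ∀ f : ι → ℤ → R,
    (∀ i, Summable fun k => ‖f i k‖) → (Summable fun m : ι → ℤ => ‖∏ i, f i (m i)‖) ∧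
      ∑' m : ι → ℤ, ∏ i, f i (m i) = ∏ i, ∑' k, f i k)
  · intro α β _ e ih f hf
    let _ := Fintype.ofEquiv β e.symm
    obtain ⟨h1, h2⟩ := ih (fun a => f (e a)) (fun a => hf _)
    have key : ∀ m : α → ℤ, ∏ b, f b (e.arrowCongr (Equiv.refl ℤ) m b) =
        ∏ a, f (e a) (m a) := fun m => by
      rw [← e.prod_comp]
      simp [Equiv.arrowCongr_apply]
    rw [← (e.arrowCongr (Equiv.refl ℤ)).summable_iff, ← (e.arrowCongr (Equiv.refl ℤ)).tsum_eq,
      ← e.prod_comp]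
    simp only [Function.comp_def, key]
    exact ⟨h1, h2⟩
  · intro f _
    refine ⟨summable_of_hasFiniteSupport (Set.toFinite _), ?_⟩
    rw [tsum_fintype]; simp
  · intro α _ ih f hf
    obtain ⟨h1, h2⟩ := ih (fun a => f (some a)) (fun a => hf _)
    set e := (Equiv.piOptionEquivProd (α := α) (β := fun _ => ℤ)).symm with he
    have e1 : ∀ x : ℤ × (α → ℤ), ∏ i, f i (e x i) = f none x.1 * ∏ a, f (some a) (x.2 a) :=
      fun x => by rw [Fintype.prod_option]; rfl
    rw [← e.summable_iff, ← e.tsum_eq, Fintype.prod_option, ← h2]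
    simp only [Function.comp_def, e1]
    clear_value e
    have h3 := (hf none).mul_norm h1
    have h4 := tsum_mul_tsum_of_summable_norm (hf none) h1
    rw [h4]
    exact ⟨h3, rfl⟩

theorem summable_norm_rpow_pi {ι : Type*} [Fintype ι] {σ : ℝ} (hσ : (Fintype.card ι : ℝ) < σ) :
    Summable fun m : ι → ℤ => ‖(fun i => (m i : ℝ) : ι → ℝ)‖ ^ (-σ) := by
  classical
  set b := (Pi.basisFun ℝ (ι)).restrictScalars ℤ
  have h := ZLattice.summable_norm_rpow
    (Submodule.span ℤ (Set.range (Pi.basisFun ℝ (ι)))) (-σ) (by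
      rw [Module.finrank_eq_card_basis b]; linarith)
  rw [← b.equivFun.symm.toEquiv.summable_iff] at h
  have key : ∀ m : ι → ℤ,
      ‖(fun i => (m i : ℝ) : ι → ℝ)‖ = ‖b.equivFun.symm.toEquiv m‖ := fun m => by
    change _ = ‖((b.equivFun.symm m : _) : ι → ℝ)‖
    refine congrArg norm ?_
    ext i
    simp [b, Module.Basis.equivFun_symm_apply, Pi.single_apply]
  simpa only [key, Function.comp_def] using h

open Classical in
/-- The coefficient of `e ^ (-mω t)` in the expansion of `1 / (e ^ (ω t) - 1)` in powers of
`e ^ (-ω t)` if `P` holds (this is the expansion for `Re (ω t) > 0`), and in powers of `e ^ (ω t)`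
if `P` fails (the expansion for `Re (ω t) < 0`). So it is `1` on `m ≥ 1` in the first case, and
`-1` on `m ≤ 0` in the second. -/
def expansionCoeff (P : Prop) (m : ℤ) : ℂ :=
  (if 1 ≤ m then 1 else 0) - (if P then 0 else 1)

theorem expansionCoeff_of_true {P : Prop} (h : P) (m : ℤ) :
    expansionCoeff P m = if 1 ≤ m then 1 else 0 := by
  simp [expansionCoeff, h]

theorem expansionCoeff_of_false {P : Prop} (h : ¬P) (m : ℤ) :
    expansionCoeff P m = if m ≤ 0 then -1 else 0 := by
  simp only [expansionCoeff, h, if_false]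
  split_ifs <;> first | omega | simp

theorem norm_expansionCoeff_le (P : Prop) (m : ℤ) : ‖expansionCoeff P m‖ ≤ 1 := by
  by_cases h : P
  · rw [expansionCoeff_of_true h]; split_ifs <;> simp
  · rw [expansionCoeff_of_false h]; split_ifs <;> simp

theorem hasSum_expansionCoeff_of_true {P : Prop} (h : P) {q : ℂ} (hq0 : q ≠ 0) (hq : ‖q‖ < 1) :
    HasSum (fun m : ℤ => expansionCoeff P m * q ^ m) (1 / (q⁻¹ - 1)) := by
  have hinj : Function.Injective fun l : ℕ => (l : ℤ) + 1 := fun a b h => by simpa using h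
  rw [← hinj.hasSum_iff]
  · have h1 := (hasSum_geometric_of_norm_lt_one hq).mul_left q
    have e : q * (1 - q)⁻¹ = 1 / (q⁻¹ - 1) := by
      have : 1 - q ≠ 0 := fun h => by
        rw [← sub_eq_zero.mp h] at hq; simp at hq
      have h3 : q⁻¹ - 1 = q⁻¹ * (1 - q) := by field_simp
      rw [h3]; field_simp
    rw [← e]
    refine h1.congr_fun fun l => ?_
    rw [Function.comp_apply, expansionCoeff_of_true h, if_pos (by omega), one_mul,
      ← zpow_natCast, zpow_add_one₀ hq0, mul_comm]
  · intro m hm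
    rw [expansionCoeff_of_true h, if_neg, zero_mul]
    exact fun h1 => hm ⟨(m - 1).toNat, by simp; omega⟩

theorem hasSum_expansionCoeff_of_false {P : Prop} (h : ¬P) {q : ℂ} (hq : 1 < ‖q‖) :
    HasSum (fun m : ℤ => expansionCoeff P m * q ^ m) (1 / (q⁻¹ - 1)) := by
  have hinj : Function.Injective fun l : ℕ => -(l : ℤ) := fun a b h => by simpa using h
  rw [← hinj.hasSum_iff]
  · have h1 := (hasSum_geometric_of_norm_lt_one (ξ := q⁻¹)
      (by rw [norm_inv]; exact inv_lt_one_of_one_lt₀ hq)).neg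
    have e : -(1 - q⁻¹)⁻¹ = 1 / (q⁻¹ - 1) := by
      rw [one_div, ← inv_neg, neg_sub]
    rw [← e]
    refine h1.congr_fun fun l => ?_
    rw [Function.comp_apply, expansionCoeff_of_false h, if_pos (by omega), zpow_neg, zpow_natCast,
      inv_pow]
    ring
  · intro m hm
    rw [expansionCoeff_of_false h, if_neg, zero_mul]
    exact fun h1 => hm ⟨(-m).toNat, by simp; omega⟩

theorem norm_exp_two_pi_I_mul (r : ℕ+) (τ : ℂ) :
    ‖exp (2 * Real.pi * I * r * τ)‖ = Real.exp (-(2 * Real.pi * r * τ.im)) := by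
  rw [norm_exp]
  congr 1
  simp

theorem hasSum_expansionCoeff_mul_exp (r : ℕ+) {τ : ℂ} (hτ : τ.im ≠ 0) :
    HasSum (fun m : ℤ => expansionCoeff (0 < τ.im) m * exp (2 * Real.pi * I * r * (m * τ)))
      (1 / (exp (-2 * Real.pi * I * r * τ) - 1)) := by
  have e1 : ∀ m : ℤ, exp (2 * Real.pi * I * r * (m * τ)) = exp (2 * Real.pi * I * r * τ) ^ m :=
    fun m => by rw [← exp_int_mul]; congr 1; ring
  have e2 : exp (-2 * Real.pi * I * r * τ) = (exp (2 * Real.pi * I * r * τ))⁻¹ := by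
    rw [← exp_neg]; congr 1; ring
  have hr : (0 : ℝ) < (r : ℕ) := by exact_mod_cast r.pos
  have hr' : (0 : ℝ) < 2 * Real.pi * (r : ℕ) := by positivity
  simp only [e1, e2]
  by_cases h : 0 < τ.im
  · refine hasSum_expansionCoeff_of_true h (exp_ne_zero _) ?_
    rw [norm_exp_two_pi_I_mul, Real.exp_lt_one_iff]
    nlinarith [mul_pos hr' h]
  · refine hasSum_expansionCoeff_of_false h ?_
    rw [norm_exp_two_pi_I_mul, Real.one_lt_exp_iff]
    have h' : 0 < -τ.im := by
      rcases lt_or_gt_of_ne hτ with h1 | h1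
      · linarith
      · exact absurd h1 h
    nlinarith [mul_pos hr' h']

theorem abs_mul_abs_of_expansionCoeff_ne_zero {x : ℝ} {m : ℤ}
    (h : expansionCoeff (0 < x) m ≠ 0) : |(m : ℝ)| * |x| = m * x := by
  by_cases hx : 0 < x
  · rw [expansionCoeff_of_true hx] at h
    have hm : 1 ≤ m := by by_contra h1; simp [h1] at h
    have hm' : (1 : ℝ) ≤ m := by exact_mod_cast hm
    rw [abs_of_pos hx, abs_of_nonneg (by linarith)]
  · rw [expansionCoeff_of_false hx] at h
    have hm : m ≤ 0 := by by_contra h1; simp [h1] at h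
    have hm' : (m : ℝ) ≤ 0 := by exact_mod_cast hm
    rw [abs_of_nonpos (not_lt.mp hx), abs_of_nonpos hm', neg_mul_neg]

/-! ### Lattice sums in a half plane -/

section

variable {ι : Type*} [Fintype ι]

/-- The product over `i` of the coefficients of `e ^ (2πi r mᵢ τᵢ)` in the expansion of
`1 / (e ^ (-2πi r τᵢ) - 1)`, in the direction in which the expansion converges. -/
def latticeCoeff (τ : ι → ℂ) (m : ι → ℤ) : ℂ :=
  ∏ i, expansionCoeff (0 < (τ i).im) (m i)

/-- The product `∏ 1 / (e ^ (-2πi r τᵢ) - 1)` without its limit as `r → ∞`. -/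
def residueFactor (τ : ι → ℂ) (r : ℕ+) : ℂ :=
  (∏ i, 1 / (exp (-2 * Real.pi * I * r * τ i) - 1)) - latticeCoeff τ 0

theorem norm_latticeCoeff_le (τ : ι → ℂ) (m : ι → ℤ) : ‖latticeCoeff τ m‖ ≤ 1 := by
  rw [latticeCoeff, norm_prod]
  exact Finset.prod_le_one (fun _ _ => norm_nonneg _) fun _ _ => norm_expansionCoeff_le _ _

theorem exists_pos_le_abs_im {τ : ι → ℂ} (hτ : ∀ i, (τ i).im ≠ 0) :
    ∃ y : ℝ, 0 < y ∧ ∀ i, y ≤ |(τ i).im| := by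
  rcases isEmpty_or_nonempty ι with h | h
  · exact ⟨1, one_pos, fun i => (h.false i).elim⟩
  · obtain ⟨i, hi⟩ := Finite.exists_min fun i => |(τ i).im|
    exact ⟨_, abs_pos.mpr (hτ i), hi⟩

theorem le_im_of_latticeCoeff_ne_zero {τ : ι → ℂ} {y : ℝ} (hy : ∀ i, y ≤ |(τ i).im|)
    {m : ι → ℤ} (h : latticeCoeff τ m ≠ 0) :
    y * ∑ i, |(m i : ℝ)| ≤ (∑ i, (m i : ℂ) * τ i).im := by
  rw [im_sum, Finset.mul_sum]
  refine Finset.sum_le_sum fun i _ => ?_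
  have h1 := abs_mul_abs_of_expansionCoeff_ne_zero (Finset.prod_ne_zero_iff.mp h i (mem_univ i))
  have h2 : ((m i : ℂ) * τ i).im = m i * (τ i).im := by simp
  rw [h2, ← h1, mul_comm]
  exact mul_le_mul_of_nonneg_left (hy i) (abs_nonneg _)

theorem norm_latticeCoeff_mul_exp_le {τ : ι → ℂ} {y : ℝ} (hy : ∀ i, y ≤ |(τ i).im|)
    (m : ι → ℤ) (r : ℕ+) :
    ‖latticeCoeff τ m * exp (2 * Real.pi * I * r * ∑ i, (m i : ℂ) * τ i)‖ ≤
      Real.exp (-(2 * Real.pi * r * (y * ∑ i, |(m i : ℝ)|))) := by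
  by_cases h : latticeCoeff τ m = 0
  · rw [h, zero_mul, norm_zero]; positivity
  · rw [norm_mul, norm_exp_two_pi_I_mul]
    refine (mul_le_of_le_one_left (Real.exp_pos _).le (norm_latticeCoeff_le τ m)).trans ?_
    refine Real.exp_le_exp.mpr (neg_le_neg ?_)
    exact mul_le_mul_of_nonneg_left (le_im_of_latticeCoeff_ne_zero hy h) (by positivity)

theorem one_le_sum_abs_of_ne_zero {m : ι → ℤ} (hm : m ≠ 0) : 1 ≤ ∑ i, |(m i : ℝ)| := by
  obtain ⟨i, hi⟩ := Function.ne_iff.mp hm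
  have h1 : (1 : ℝ) ≤ |(m i : ℝ)| := by
    exact_mod_cast Int.one_le_abs hi
  exact h1.trans (Finset.single_le_sum (f := fun i => |(m i : ℝ)|) (fun _ _ => abs_nonneg _)
    (mem_univ i))

/-- The majorant that separates the two summations: `r N ≥ (r + N) / 2` for `r, N ≥ 1`. -/
theorem norm_ite_latticeCoeff_mul_exp_le {τ : ι → ℂ} {y : ℝ} (hy0 : 0 < y)
    (hy : ∀ i, y ≤ |(τ i).im|) (m : ι → ℤ) (r : ℕ+) [Decidable (m = 0)] :
    ‖if m = 0 then 0 else latticeCoeff τ m * exp (2 * Real.pi * I * r * ∑ i, (m i : ℂ) * τ i)‖ ≤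
      Real.exp (-(Real.pi * y * ∑ i, |(m i : ℝ)|)) * Real.exp (-(Real.pi * y * r)) := by
  split_ifs with hm
  · rw [norm_zero]; positivity
  · refine (norm_latticeCoeff_mul_exp_le hy m r).trans ?_
    rw [← Real.exp_add]
    refine Real.exp_le_exp.mpr ?_
    have h1 := one_le_sum_abs_of_ne_zero hm
    have h2 : (1 : ℝ) ≤ (r : ℕ) := by exact_mod_cast (one_le (a := r))
    have h3 : 0 < Real.pi * y := by positivity
    have h4 : (r : ℕ) + ∑ i, |(m i : ℝ)| ≤ 2 * ((r : ℕ) * ∑ i, |(m i : ℝ)|) := by nlinarith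
    have h5 := mul_le_mul_of_nonneg_left h4 h3.le
    linarith

theorem summable_int_exp_neg_abs {c : ℝ} (hc : 0 < c) :
    Summable fun k : ℤ => Real.exp (-(c * |(k : ℝ)|)) := by
  have h : Summable fun k : ℕ => Real.exp (-(c * (k : ℝ))) := by
    have := Real.summable_pow_mul_exp_neg_nat_mul 0 hc
    simpa using this
  rw [summable_int_iff_summable_nat_and_neg]
  constructor <;> simpa using h

theorem summable_exp_neg_sum_abs {c : ℝ} (hc : 0 < c) :
    Summable fun m : ι → ℤ => Real.exp (-(c * ∑ i, |(m i : ℝ)|)) := by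
  have h := (summable_norm_prod_pi (fun (_ : ι) (k : ℤ) => Real.exp (-(c * |(k : ℝ)|)))
    (fun _ => (summable_int_exp_neg_abs hc).norm)).1
  refine h.congr fun m => ?_
  rw [← Real.exp_sum, Real.norm_of_nonneg (Real.exp_pos _).le, Finset.sum_neg_distrib,
    Finset.mul_sum]

theorem summable_rpow_mul_exp_neg (a : ℝ) {c : ℝ} (hc : 0 < c) :
    Summable fun r : ℕ+ => ((r : ℕ) : ℝ) ^ a * Real.exp (-(c * (r : ℕ))) := by
  have h := (Real.summable_pow_mul_exp_neg_nat_mul ⌈a⌉₊ hc).comp_injective PNat.coe_injective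
  refine Summable.of_nonneg_of_le (fun r => by positivity) (fun r => ?_) h
  simp only [Function.comp_apply, neg_mul]
  refine mul_le_mul_of_nonneg_right ?_ (Real.exp_pos _).le
  rw [← Real.rpow_natCast]
  exact Real.rpow_le_rpow_of_exponent_le (by exact_mod_cast (one_le (a := r))) (Nat.le_ceil a)

open Classical in
theorem hasSum_residueFactor {τ : ι → ℂ} (hτ : ∀ i, (τ i).im ≠ 0) (r : ℕ+) :
    HasSum (fun m : ι → ℤ => if m = 0 then 0 else
      latticeCoeff τ m * exp (2 * Real.pi * I * r * ∑ i, (m i : ℂ) * τ i))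
      (residueFactor τ r) := by
  have h := summable_norm_prod_pi (fun (i : ι) (k : ℤ) =>
    expansionCoeff (0 < (τ i).im) k * exp (2 * Real.pi * I * r * (k * τ i)))
    (fun i => (hasSum_expansionCoeff_mul_exp r (hτ i)).summable.norm)
  have e1 : ∀ m : ι → ℤ, ∏ i, (expansionCoeff (0 < (τ i).im) (m i) *
      exp (2 * Real.pi * I * r * (m i * τ i))) =
      latticeCoeff τ m * exp (2 * Real.pi * I * r * ∑ i, (m i : ℂ) * τ i) := fun m => by
    rw [Finset.prod_mul_distrib, ← exp_sum, ← Finset.mul_sum]; rfl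
  have h1 := h.1.of_norm.hasSum
  rw [h.2] at h1
  have h2 := hasSum_ite_sub_hasSum h1 0
  simp only [e1] at h2
  have e2 : residueFactor τ r = ∏ i, ∑' k : ℤ, expansionCoeff (0 < (τ i).im) k *
      exp (2 * Real.pi * I * r * (k * τ i)) - latticeCoeff τ 0 *
        exp (2 * Real.pi * I * r * ∑ i, (((0 : ι → ℤ) i : ℤ) : ℂ) * τ i) := by
    unfold residueFactor
    congr 1
    · exact Finset.prod_congr rfl fun i _ => (hasSum_expansionCoeff_mul_exp r (hτ i)).tsum_eq.symm
    · simp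
  rw [e2]
  exact h2

theorem exists_norm_residueFactor_le {τ : ι → ℂ} (hτ : ∀ i, (τ i).im ≠ 0) :
    ∃ c > 0, ∃ K : ℝ, 0 ≤ K ∧ ∀ r : ℕ+, ‖residueFactor τ r‖ ≤ K * Real.exp (-(c * (r : ℕ))) := by
  classical
  obtain ⟨y, hy0, hy⟩ := exists_pos_le_abs_im hτ
  have hc : 0 < Real.pi * y := by positivity
  refine ⟨Real.pi * y, hc, ∑' m : ι → ℤ, Real.exp (-(Real.pi * y * ∑ i, |(m i : ℝ)|)),
    tsum_nonneg fun _ => (Real.exp_pos _).le, fun r => ?_⟩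
  rw [← (hasSum_residueFactor hτ r).tsum_eq]
  exact tsum_of_norm_bounded ((summable_exp_neg_sum_abs hc).hasSum.mul_right _)
    fun m => norm_ite_latticeCoeff_mul_exp_le hy0 hy m r

theorem ofReal_mul_cpow {x : ℝ} (hx : 0 < x) {w : ℂ} (hw : w ≠ 0) (s : ℂ) :
    ((x : ℂ) * w) ^ s = (x : ℂ) ^ s * w ^ s := by
  have hx' : (x : ℂ) ≠ 0 := ofReal_ne_zero.mpr hx.ne'
  rw [cpow_def_of_ne_zero (mul_ne_zero hx' hw), cpow_def_of_ne_zero hx', cpow_def_of_ne_zero hw,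
    log_ofReal_mul hx hw, add_mul, exp_add, ofReal_log hx.le]

/-- The case `z = 0` of Lipschitz's formula, which is the functional equation of `ζ`. -/
theorem gamma_mul_tsum_int_cpow_neg {s : ℂ} (hs : 1 < s.re) :
    Gamma s * ∑' l : ℤ, (if l = 0 then 0 else (-2 * Real.pi * I * l) ^ (-s)) =
      riemannZeta (1 - s) := by
  have hs0 : s ≠ 0 := fun h => by rw [h] at hs; simp at hs; linarith
  have hs1 : s ≠ 1 := fun h => by rw [h] at hs; simp at hs
  have hpi : (0 : ℝ) < 2 * Real.pi := by positivity
  have hζ : HasSum (fun k : ℕ => (((k : ℂ) + 1) ^ (-s))) (riemannZeta s) := by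
    rw [zeta_eq_tsum_one_div_nat_add_one_cpow hs]
    have h := (Complex.summable_one_div_nat_cpow (p := s)).mpr hs
    have h' := ((summable_nat_add_iff 1).mpr h).hasSum
    simp only [Nat.cast_add, Nat.cast_one] at h'
    simpa only [cpow_neg, one_div] using h'
  have key : ∀ (k : ℕ) (ε : ℂ), ε ≠ 0 → ((2 * Real.pi : ℝ) * (((k : ℝ) + 1 : ℝ) * ε)) ^ (-s) =
      ((k : ℂ) + 1) ^ (-s) * ((2 * Real.pi : ℂ) ^ (-s) * ε ^ (-s)) := by
    intro k ε hε
    have hk : (0 : ℝ) < (k : ℝ) + 1 := by positivity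
    rw [ofReal_mul_cpow hpi (mul_ne_zero (ofReal_ne_zero.mpr hk.ne') hε), ofReal_mul_cpow hk hε]
    push_cast
    ring
  have h1 : HasSum (fun k : ℕ => if ((k : ℤ) + 1) = 0 then (0 : ℂ) else
      (-2 * Real.pi * I * (((k : ℤ) + 1 : ℤ) : ℂ)) ^ (-s))
      (riemannZeta s * ((2 * Real.pi : ℂ) ^ (-s) * (-I) ^ (-s))) := by
    refine (hζ.mul_right _).congr_fun fun k => ?_
    rw [if_neg (by omega), ← key k (-I) (neg_ne_zero.mpr I_ne_zero)]
    congr 1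
    push_cast
    ring
  have h2 : HasSum (fun k : ℕ => if (-((k : ℤ) + 1)) = 0 then (0 : ℂ) else
      (-2 * Real.pi * I * ((-((k : ℤ) + 1) : ℤ) : ℂ)) ^ (-s))
      (riemannZeta s * ((2 * Real.pi : ℂ) ^ (-s) * I ^ (-s))) := by
    refine (hζ.mul_right _).congr_fun fun k => ?_
    rw [if_neg (by omega), ← key k I I_ne_zero]
    congr 1
    push_cast
    ring
  have h3 := HasSum.of_add_one_of_neg_add_one (f := fun l : ℤ =>
    if l = 0 then (0 : ℂ) else (-2 * Real.pi * I * (l : ℂ)) ^ (-s)) h1 h2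
  simp only [if_true, add_zero] at h3
  rw [h3.tsum_eq, riemannZeta_one_sub (fun n h => by rw [h] at hs; simp at hs; linarith) hs1]
  rw [cpow_def_of_ne_zero (neg_ne_zero.mpr I_ne_zero), cpow_def_of_ne_zero I_ne_zero, log_neg_I,
    log_I, cos]
  have e1 : -(Real.pi / 2 : ℂ) * I * -s = Real.pi * s / 2 * I := by ring
  have e2 : (Real.pi / 2 : ℂ) * I * -s = -(Real.pi * s / 2) * I := by ring
  rw [e1, e2]
  ring

open Classical in
/-- The sum over a lattice of rank `|ι| + 1` in a half plane bounded by one of its generating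
directions: Lipschitz's formula is applied to each line in that direction, and the remaining
geometric series are summed. The line through the origin, which is met only if all
`Im τᵢ` are negative, contributes the term with `ζ(1 - s)`. -/
theorem gamma_mul_tsum_latticeCoeff {τ : ι → ℂ} (hτ : ∀ i, (τ i).im ≠ 0) {s : ℂ} (hs : 1 < s.re)
    (hsum : Summable fun p : (ι → ℤ) × ℤ => if p = 0 then 0 else
      latticeCoeff τ p.1 * (-2 * Real.pi * I * (p.2 + ∑ i, (p.1 i : ℂ) * τ i)) ^ (-s)) :
    Gamma s * ∑' p : (ι → ℤ) × ℤ, (if p = 0 then 0 else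
      latticeCoeff τ p.1 * (-2 * Real.pi * I * (p.2 + ∑ i, (p.1 i : ℂ) * τ i)) ^ (-s)) =
      ∑' r : ℕ+, (r : ℂ) ^ (s - 1) * residueFactor τ r +
        latticeCoeff τ 0 * riemannZeta (1 - s) := by
  obtain ⟨y, hy0, hy⟩ := exists_pos_le_abs_im hτ
  have hc : 0 < Real.pi * y := by positivity
  set G : (ι → ℤ) → ℂ := fun m => ∑' l : ℤ, (if (m, l) = 0 then 0 else
    latticeCoeff τ m * (-2 * Real.pi * I * (l + ∑ i, (m i : ℂ) * τ i)) ^ (-s)) with hG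
  set T : (ι → ℤ) → ℕ+ → ℂ := fun m r => (r : ℂ) ^ (s - 1) * (if m = 0 then 0 else
      latticeCoeff τ m * exp (2 * Real.pi * I * r * ∑ i, (m i : ℂ) * τ i)) with hT
  have hG0 : Gamma s * G 0 = latticeCoeff τ 0 * riemannZeta (1 - s) := by
    rw [← gamma_mul_tsum_int_cpow_neg hs, mul_left_comm, ← tsum_mul_left (a := latticeCoeff τ 0)]
    congr 1
    refine tsum_congr fun l => ?_
    have : ((0 : ι → ℤ), l) = 0 ↔ l = 0 := by simp [Prod.ext_iff]
    by_cases hl : l = 0 <;> simp [hl]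
  have hGm : ∀ m, m ≠ 0 → Gamma s * G m = ∑' r : ℕ+, T m r := by
    intro m hm
    have h1 : ∀ l : ℤ, ¬((m, l) = 0) := fun l h => hm (Prod.ext_iff.mp h).1
    simp only [hG, hT, h1, hm, if_false]
    rw [tsum_mul_left]
    by_cases h : latticeCoeff τ m = 0
    · simp [h]
    · have hz := le_im_of_latticeCoeff_ne_zero hy h
      have hN := one_le_sum_abs_of_ne_zero hm
      rw [mul_left_comm, lipschitz_formula hs (by nlinarith), ← tsum_mul_left]
      exact tsum_congr fun r => by ring
  have hTs : Summable (Function.uncurry T) := by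
    have h := (summable_exp_neg_sum_abs (ι := ι) hc).mul_of_nonneg
      (summable_rpow_mul_exp_neg (s.re - 1) hc) (fun _ => (Real.exp_pos _).le)
      (fun _ => by positivity)
    refine Summable.of_norm_bounded h fun p => ?_
    obtain ⟨m, r⟩ := p
    have hr : (0 : ℝ) < (r : ℕ) := by exact_mod_cast r.pos
    simp only [Function.uncurry, hT, norm_mul]
    have e : ‖(r : ℂ) ^ (s - 1)‖ = ((r : ℕ) : ℝ) ^ (s.re - 1) := by
      rw [← ofReal_natCast, norm_cpow_eq_rpow_re_of_pos hr]; simp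
    rw [e]
    refine (mul_le_mul_of_nonneg_left (norm_ite_latticeCoeff_mul_exp_le hy0 hy m r)
      (by positivity)).trans (le_of_eq (by ring))
  rw [hsum.tsum_prod, ← tsum_mul_left]
  have hsG : Summable fun m => Gamma s * G m := (hsum.prod).mul_left _
  rw [hsG.tsum_eq_add_tsum_ite 0, add_comm, ← hG0]
  congr 1
  have e2 : ∀ m, (if m = 0 then 0 else Gamma s * G m) = ∑' r : ℕ+, T m r := by
    intro m
    split_ifs with hm
    · simp [hT, hm]
    · exact hGm m hm
  simp only [e2]
  rw [← hTs.tsum_comm]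
  refine tsum_congr fun r => ?_
  simp only [hT]
  rw [tsum_mul_left, (hasSum_residueFactor hτ r).tsum_eq]

end

/-! ### Sums of jumps and absolute convergence of the lattice sums -/

section

open Filter in
/-- A function on `[a, b]` that is locally constant except for jumps `J k` immediately to the right
of the points `p k` increases by the sum of the jumps. -/
theorem sub_eq_sum_jumps {κ : Type*} [Fintype κ] {a b : ℝ} (hab : a ≤ b) {p : κ → ℝ} {J : κ → ℂ}
    {f : ℝ → ℂ} (hinj : Function.Injective p) (hp : ∀ k, a ≤ p k ∧ p k < b)
    (hleft : ∀ x ∈ Set.Icc a b, ∀ᶠ y in 𝓝[<] x, f y = f x)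
    (hright : ∀ x ∈ Set.Ico a b, x ∉ Set.range p → ∀ᶠ y in 𝓝[>] x, f y = f x)
    (hjump : ∀ k, ∀ᶠ y in 𝓝[>] p k, f y = f (p k) + J k) :
    f b - f a = ∑ k, J k := by
  classical
  -- Subtracting the accumulated jumps leaves a locally constant function.
  set h : ℝ → ℂ := fun x => f x - ∑ k, if p k < x then J k else 0 with hh
  have hS1 : ∀ x : ℝ, ∀ᶠ y in 𝓝[<] x, ∀ k, (p k < y ↔ p k < x) := fun x => by
    rw [eventually_all]
    intro k
    by_cases hk : p k < x
    · filter_upwards [mem_nhdsWithin_of_mem_nhds (lt_mem_nhds hk)] with y hy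
      exact iff_of_true hy hk
    · filter_upwards [self_mem_nhdsWithin] with y hy
      exact iff_of_false (fun h1 => hk (h1.trans hy)) hk
  have hS2 : ∀ x : ℝ, ∀ᶠ y in 𝓝[>] x, ∀ k, (p k < y ↔ p k ≤ x) := fun x => by
    rw [eventually_all]
    intro k
    by_cases hk : p k ≤ x
    · filter_upwards [self_mem_nhdsWithin] with y hy
      exact iff_of_true (hk.trans_lt hy) hk
    · filter_upwards [mem_nhdsWithin_of_mem_nhds (gt_mem_nhds (not_le.mp hk))] with y hy
      exact iff_of_false (fun h1 => lt_asymm h1 hy) hk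
  have hl : ∀ x ∈ Set.Icc a b, ∀ᶠ y in 𝓝[<] x, h y = h x := fun x hx => by
    filter_upwards [hleft x hx, hS1 x] with y h1 h2
    simp only [hh, h1, h2]
  have hr : ∀ x ∈ Set.Ico a b, ∀ᶠ y in 𝓝[>] x, h y = h x := fun x hx => by
    by_cases hxp : x ∈ Set.range p
    · obtain ⟨k, rfl⟩ := hxp
      filter_upwards [hjump k, hS2 (p k)] with y h1 h2
      have e : ∀ i, (if p i < y then J i else 0) =
          (if p i < p k then J i else 0) + if i = k then J k else 0 := fun i => by
        rcases eq_or_ne i k with rfl | hik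
        · simp [(h2 i).mpr le_rfl]
        · simp only [h2 i, hik, if_false, add_zero, (hinj.ne hik).le_iff_lt]
      simp only [hh, h1, e, Finset.sum_add_distrib, Finset.sum_ite_eq', mem_univ, if_true]
      ring
    · filter_upwards [hright x hx hxp, hS2 x] with y h1 h2
      have e : ∀ i, (p i < y ↔ p i < x) := fun i => by
        rw [h2 i]
        exact ⟨fun h3 => lt_of_le_of_ne h3 fun h4 => hxp ⟨i, h4⟩, le_of_lt⟩
      simp only [hh, h1, e]
  have hconst : h b = h a := by
    refine constant_of_has_deriv_right_zero (a := a) (b := b) ?_ ?_ b ⟨hab, le_rfl⟩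
    · intro x hx
      have h1 : ContinuousWithinAt h (Set.Iio x) x :=
        (tendsto_const_nhds).congr' ((hl x hx).mono fun y hy => hy.symm)
      rcases eq_or_lt_of_le hx.2 with rfl | hxb
      · refine (continuousWithinAt_insert_self.mpr h1).mono ?_
        intro y hy
        rcases eq_or_lt_of_le hy.2 with h3 | h3
        · exact Or.inl h3
        · exact Or.inr h3
      · have h2 : ContinuousWithinAt h (Set.Ioi x) x :=
          (tendsto_const_nhds).congr' ((hr x ⟨hx.1, hxb⟩).mono fun y hy => hy.symm)
        exact (continuousAt_iff_continuous_left'_right'.mpr ⟨h1, h2⟩).continuousWithinAt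
    · intro x hx
      refine (hasDerivWithinAt_Ioi_iff_Ici).mp ?_
      exact (hasDerivWithinAt_const x _ (h x)).congr_of_eventuallyEq (hr x hx) rfl
  have ea : ∀ k, ¬ p k < a := fun k => not_lt.mpr (hp k).1
  have eb : ∀ k, p k < b := fun k => (hp k).2
  simp only [hh, ea, eb, if_true, if_false, Finset.sum_const_zero, sub_zero] at hconst
  rw [← hconst]
  ring

variable {ι : Type*} [Fintype ι]

/-- On the support of `latticeCoeff` the point `l + ∑ mᵢ τᵢ` is comparable to `(l, m)`: the terms
of its imaginary part do not cancel, so this bounds `m`, and then its norm bounds `l`. -/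
theorem exists_mul_sum_abs_le_norm {τ : ι → ℂ} (hτ : ∀ i, (τ i).im ≠ 0) :
    ∃ c : ℝ, 0 < c ∧ ∀ (m : ι → ℤ) (l : ℤ), latticeCoeff τ m ≠ 0 →
      c * (|(l : ℝ)| + ∑ i, |(m i : ℝ)|) ≤ ‖(l : ℂ) + ∑ i, (m i : ℂ) * τ i‖ := by
  obtain ⟨y, hy0, hy⟩ := exists_pos_le_abs_im hτ
  set T : ℝ := ∑ i, ‖τ i‖ with hT
  have hT0 : 0 ≤ T := Finset.sum_nonneg fun _ _ => norm_nonneg _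
  refine ⟨y / (y + T + 1), by positivity, fun m l hm => ?_⟩
  set N : ℝ := ∑ i, |(m i : ℝ)| with hN
  set u : ℂ := (l : ℂ) + ∑ i, (m i : ℂ) * τ i with hu
  have h1 : y * N ≤ ‖u‖ := by
    refine (le_im_of_latticeCoeff_ne_zero hy hm).trans ((le_abs_self _).trans ?_)
    have : (∑ i, (m i : ℂ) * τ i).im = u.im := by simp [hu]
    rw [this]
    exact abs_im_le_norm _
  have h2 : ‖∑ i, (m i : ℂ) * τ i‖ ≤ T * N := by
    refine (norm_sum_le _ _).trans ?_
    rw [hN, Finset.mul_sum]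
    refine Finset.sum_le_sum fun i _ => ?_
    rw [norm_mul, norm_intCast, mul_comm]
    exact mul_le_mul_of_nonneg_right
      (Finset.single_le_sum (f := fun i => ‖τ i‖) (fun _ _ => norm_nonneg _) (mem_univ i))
      (abs_nonneg _)
  have h3 : |(l : ℝ)| ≤ ‖u‖ + T * N := by
    have h4 := norm_sub_le u (∑ i, (m i : ℂ) * τ i)
    rw [hu, add_sub_cancel_right, norm_intCast] at h4
    exact h4.trans (add_le_add_right h2 _)
  rw [div_mul_eq_mul_div, div_le_iff₀ (by positivity)]
  nlinarith [mul_le_mul_of_nonneg_left h1 hT0, mul_le_mul_of_nonneg_left h3 hy0.le]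

theorem norm_le_sum_abs (m : ι → ℤ) : ‖(fun i => (m i : ℝ) : ι → ℝ)‖ ≤ ∑ i, |(m i : ℝ)| := by
  refine (pi_norm_le_iff_of_nonneg (Finset.sum_nonneg fun _ _ => abs_nonneg _)).mpr fun i => ?_
  exact Finset.single_le_sum (f := fun i => |(m i : ℝ)|) (fun _ _ => abs_nonneg _) (mem_univ i)

open Classical in
theorem summable_latticeCoeff_mul_cpow {τ : ι → ℂ} (hτ : ∀ i, (τ i).im ≠ 0) {s : ℂ}
    (hs : (Fintype.card ι : ℝ) + 1 < s.re) :
    Summable fun p : (ι → ℤ) × ℤ => if p = 0 then 0 else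
      latticeCoeff τ p.1 * (-2 * Real.pi * I * (p.2 + ∑ i, (p.1 i : ℂ) * τ i)) ^ (-s) := by
  obtain ⟨c, hc, h⟩ := exists_mul_sum_abs_le_norm hτ
  have h1 := summable_norm_rpow_pi (ι := Option ι) (σ := s.re) (by simpa using hs)
  rw [← ((Equiv.piOptionEquivProd (α := ι) (β := fun _ => ℤ)).trans
    (Equiv.prodComm _ _)).summable_iff]
  refine Summable.of_norm_bounded
    (h1.mul_left (Real.exp (Real.pi * |s.im|) * (2 * Real.pi * c) ^ (-s.re))) fun m => ?_
  simp only [Function.comp_apply, Equiv.trans_apply, Equiv.prodComm_apply,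
    Equiv.piOptionEquivProd_apply, Prod.swap_prod_mk]
  have hpos : 0 ≤ Real.exp (Real.pi * |s.im|) * (2 * Real.pi * c) ^ (-s.re) *
      ‖(fun i => (m i : ℝ) : Option ι → ℝ)‖ ^ (-s.re) := by positivity
  split_ifs with h0
  · rw [norm_zero]; exact hpos
  rcases eq_or_ne (latticeCoeff τ fun i => m (some i)) 0 with h2 | h2
  · rw [h2, zero_mul, norm_zero]; exact hpos
  have hm : m ≠ 0 := fun hm => h0 (by rw [hm]; rfl)
  have hnorm : 0 < ‖(fun i => (m i : ℝ) : Option ι → ℝ)‖ := by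
    rw [norm_pos_iff]
    intro h3
    exact hm (funext fun i => by simpa using congrFun h3 i)
  rw [norm_mul]
  refine (mul_le_of_le_one_left (norm_nonneg _) (norm_latticeCoeff_le _ _)).trans ?_
  refine (norm_cpow_neg_le _ _).trans ?_
  rw [mul_assoc (Real.exp _), ← Real.mul_rpow (by positivity) hnorm.le]
  refine mul_le_mul_of_nonneg_left ?_ (Real.exp_pos _).le
  refine Real.rpow_le_rpow_of_nonpos (by positivity) ?_ (by
    have : (0 : ℝ) ≤ Fintype.card ι := by positivity
    linarith)
  have h4 := norm_le_sum_abs m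
  rw [Fintype.sum_option] at h4
  have h5 := (mul_le_mul_of_nonneg_left h4 hc.le).trans (h _ (m none) h2)
  have e : ‖(-2 * Real.pi * I : ℂ)‖ = 2 * Real.pi := by simp [abs_of_pos Real.pi_pos]
  rw [norm_mul, e, mul_assoc]
  exact mul_le_mul_of_nonneg_left h5 (by positivity)

end

/-! ### Rotation of the half plane -/

theorem logAround_mul_exp {c r γ : ℝ} (hr : 0 < r) (h1 : c - Real.pi < γ)
    (h2 : γ ≤ c + Real.pi) :
    logAround c ((r : ℂ) * exp (γ * I)) = Real.log r + γ * I := by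
  rw [logAround, mul_assoc, ← exp_add, log_ofReal_mul hr (exp_ne_zero _), log_exp]
  · ring
  · simp; linarith
  · simp; linarith

theorem logAround_add_two_pi (c : ℝ) (z : ℂ) :
    logAround (c + 2 * Real.pi) z = logAround c z + 2 * Real.pi * I := by
  have e : exp (-(((c + 2 * Real.pi : ℝ) : ℂ) * I)) = exp (-(c * I)) := by
    push_cast
    rw [add_mul, neg_add, exp_add, exp_neg (2 * Real.pi * I), exp_two_pi_mul_I, inv_one, mul_one]
  rw [logAround, logAround, e]
  push_cast
  ring

open Filter in
/-- The logarithm of a point of the closed half plane around `x` is not affected by a small change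
of `x`, since the cut is on the opposite side. -/
theorem eventually_logAround_eq {x : ℝ} {w : ℂ} (hw : w ≠ 0)
    (h : 0 ≤ (w * exp (-((x : ℂ) * I))).re) : ∀ᶠ y in 𝓝 x, logAround y w = logAround x w := by
  filter_upwards [Metric.ball_mem_nhds x (show 0 < Real.pi / 2 by positivity)] with y hy
  rw [Metric.mem_ball, Real.dist_eq, abs_lt] at hy
  have harg := abs_le.mp (abs_arg_le_pi_div_two_iff.mpr h)
  set v := w * exp (-((x : ℂ) * I)) with hv
  have hv0 : v ≠ 0 := mul_ne_zero hw (exp_ne_zero _)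
  have e : w * exp (-((y : ℂ) * I)) = exp (log v + (x - y : ℝ) * I) := by
    rw [exp_add, exp_log hv0, hv, mul_assoc, ← exp_add]
    congr 2
    push_cast
    ring
  rw [logAround, logAround, ← hv, e, log_exp]
  · push_cast
    ring
  · simp [log_im]; linarith
  · simp [log_im]; linarith

/-- For `x` in `[θ, θ + 2π]` and `b` within `π / 2` of `θ`, the condition that `e ^ (ib)` lies in
the open half plane `H(x)`; at the two values of `x` where `e ^ (ib)` lies on the boundary the
condition is made continuous from the left. -/
def InSector (b x : ℝ) : Prop :=
  x ≤ b + Real.pi / 2 ∨ b + 3 * Real.pi / 2 < x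

/-- The contribution of the lattice point `m` to the sum over the cone whose generators are those
of `± ω j` which lie in `H(x)`, the argument of the bases being near `x`. -/
def sectorTerm {n : ℕ} (β : Fin n → ℝ) (ω : Fin n → ℂ) (s : ℂ) (m : Fin n → ℤ) (x : ℝ) : ℂ :=
  (∏ j, expansionCoeff (InSector (β j) x) (m j)) * cpowAround x (∑ j, ω j * (m j : ℂ)) (-s)

/-- The angle `x` at which `H(x)` is bounded by the line through `e ^ (ib)`: it is `b + π / 2` for
`e = 1` and `b + 3π / 2` for `e = -1`. -/
def crossing (b : ℝ) (e : ℤ) : ℝ := b + Real.pi - e * (Real.pi / 2)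

/-- The jump of `sectorTerm` at the angle `crossing (β k) e`. -/
def jumpTerm {n : ℕ} (β : Fin n → ℝ) (ω : Fin n → ℂ) (s : ℂ) (m : Fin n → ℤ) (k : Fin n)
    (e : ℤ) : ℂ :=
  -e * (∏ j ∈ univ.erase k, expansionCoeff (0 < e * (ω j / ω k).im) (m j)) *
    cpowAround (crossing (β k) e) (∑ j, ω j * (m j : ℂ)) (-s)

open Filter in
theorem eventually_left_inSector (b x : ℝ) : ∀ᶠ y in 𝓝[<] x, InSector b y ↔ InSector b x := by
  by_cases h1 : b + 3 * Real.pi / 2 < x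
  · filter_upwards [mem_nhdsWithin_of_mem_nhds (lt_mem_nhds h1)] with y hy
    exact iff_of_true (Or.inr hy) (Or.inr h1)
  by_cases h2 : x ≤ b + Real.pi / 2
  · filter_upwards [self_mem_nhdsWithin] with y hy
    exact iff_of_true (Or.inl ((le_of_lt hy).trans h2)) (Or.inl h2)
  · filter_upwards [self_mem_nhdsWithin,
      mem_nhdsWithin_of_mem_nhds (lt_mem_nhds (not_le.mp h2))] with y hy hy2
    have hy' : y < x := hy
    exact iff_of_false (by rintro (h | h) <;> linarith) (by rintro (h | h) <;> linarith)

open Filter in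
theorem eventually_right_inSector {b x : ℝ} (h : ∀ e : ℤ, e = 1 ∨ e = -1 → x ≠ crossing b e) :
    ∀ᶠ y in 𝓝[>] x, InSector b y ↔ InSector b x := by
  have hA := h 1 (Or.inl rfl)
  have hB := h (-1) (Or.inr rfl)
  simp only [crossing, Int.cast_one, Int.cast_neg] at hA hB
  by_cases h1 : b + 3 * Real.pi / 2 < x
  · filter_upwards [self_mem_nhdsWithin] with y hy
    exact iff_of_true (Or.inr (h1.trans hy)) (Or.inr h1)
  have h1' : x < b + 3 * Real.pi / 2 :=
    lt_of_le_of_ne (not_lt.mp h1) fun h => hB (by rw [h]; ring)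
  by_cases h2 : x ≤ b + Real.pi / 2
  · have h2' : x < b + Real.pi / 2 := lt_of_le_of_ne h2 fun h => hA (by rw [h]; ring)
    filter_upwards [mem_nhdsWithin_of_mem_nhds (gt_mem_nhds h2')] with y hy
    exact iff_of_true (Or.inl (le_of_lt hy)) (Or.inl h2)
  · filter_upwards [self_mem_nhdsWithin,
      mem_nhdsWithin_of_mem_nhds (gt_mem_nhds h1')] with y hy hy2
    have hy' : x < y := hy
    exact iff_of_false (by rintro (h | h) <;> linarith) (by rintro (h | h) <;> linarith)

open Filter in
theorem eventually_right_crossing (b : ℝ) {e : ℤ} (he : e = 1 ∨ e = -1) (m : ℤ) :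
    ∀ᶠ y in 𝓝[>] crossing b e, expansionCoeff (InSector b y) m =
      expansionCoeff (InSector b (crossing b e)) m - e := by
  have hpi := Real.pi_pos
  rcases he with rfl | rfl
  · have h1 : InSector b (crossing b 1) := Or.inl (by simp only [crossing]; push_cast; linarith)
    have h3 : crossing b 1 < b + 3 * Real.pi / 2 := by simp only [crossing]; push_cast; linarith
    filter_upwards [self_mem_nhdsWithin,
      mem_nhdsWithin_of_mem_nhds (gt_mem_nhds h3)] with y hy hy2
    have hy' : crossing b 1 < y := hy
    have h2 : ¬ InSector b y := by
      simp only [crossing] at hy'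
      push_cast at hy'
      rintro (h | h) <;> linarith
    simp [expansionCoeff, h1, h2]
  · have h1 : ¬ InSector b (crossing b (-1)) := by
      simp only [crossing]
      push_cast
      rintro (h | h) <;> linarith
    filter_upwards [self_mem_nhdsWithin] with y hy
    have hy' : crossing b (-1) < y := hy
    have h2 : InSector b y := by
      simp only [crossing] at hy'
      push_cast at hy'
      exact Or.inr (by linarith)
    simp [expansionCoeff, h1, h2]

section

variable {n : ℕ} {θ : ℝ} {ω : Fin n → ℂ} {ρ β : Fin n → ℝ}

theorem re_sum_mul_exp (hω : ∀ j, ω j = ρ j * exp (β j * I)) (m : Fin n → ℤ) (x : ℝ) :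
    ((∑ j, ω j * (m j : ℂ)) * exp (-((x : ℂ) * I))).re =
      ∑ j, ρ j * (m j * Real.cos (β j - x)) := by
  rw [Finset.sum_mul, re_sum]
  refine Finset.sum_congr rfl fun j _ => ?_
  have e : ω j * (m j : ℂ) * exp (-((x : ℂ) * I)) =
      ((ρ j * m j : ℝ) : ℂ) * exp ((β j - x : ℝ) * I) := by
    have : exp ((β j - x : ℝ) * I) = exp (β j * I) * exp (-((x : ℂ) * I)) := by
      rw [← exp_add]; congr 1; push_cast; ring
    rw [hω, this]; push_cast; ring
  rw [e, re_ofReal_mul, exp_ofReal_mul_I_re]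
  ring

theorem im_div_eq (hω : ∀ j, ω j = ρ j * exp (β j * I)) (j k : Fin n) :
    (ω j / ω k).im = ρ j / ρ k * Real.sin (β j - β k) := by
  have e : ω j / ω k = ((ρ j / ρ k : ℝ) : ℂ) * exp ((β j - β k : ℝ) * I) := by
    rw [hω, hω, mul_div_mul_comm, ← exp_sub]; push_cast; congr 2; ring
  rw [e, im_ofReal_mul, exp_ofReal_mul_I_im]

/-- A nonzero lattice point all of whose components lie in the closed half plane around `x` does
not sum to `0`: its components would have to lie on the boundary line, which contains at most one
of the `ω j`. -/
theorem sum_ne_zero_of_cos_nonneg (hω : ∀ j, ω j = ρ j * exp (β j * I)) (hρ : ∀ j, 0 < ρ j)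
    (hβ : ∀ j, |β j - θ| < Real.pi / 2) (hinj : Function.Injective β) {m : Fin n → ℤ} (hm : m ≠ 0)
    {x : ℝ} (h : ∀ j, 0 ≤ (m j : ℝ) * Real.cos (β j - x)) :
    ∑ j, ω j * (m j : ℂ) ≠ 0 := by
  intro hw
  have h1 := re_sum_mul_exp hω m x
  rw [hw, zero_mul, zero_re] at h1
  have h2 := (Finset.sum_eq_zero_iff_of_nonneg fun j _ => mul_nonneg (hρ j).le (h j)).mp h1.symm
  have h3 : ∀ j, m j ≠ 0 → Real.cos (β j - x) = 0 := fun j hj => by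
    rcases mul_eq_zero.mp (h2 j (mem_univ j)) with h4 | h4
    · exact absurd h4 (hρ j).ne'
    · exact (mul_eq_zero.mp h4).resolve_left (by exact_mod_cast hj)
  obtain ⟨j, hj⟩ := Function.ne_iff.mp hm
  have h4 : ∀ i, i ≠ j → m i = 0 := by
    intro i hij
    by_contra hi
    have e : Real.sin (β i - β j) = 0 := by
      have : β i - β j = (β i - x) - (β j - x) := by ring
      rw [this, Real.sin_sub, h3 i hi, h3 j hj]
      ring
    have hi' := abs_lt.mp (hβ i)
    have hj' := abs_lt.mp (hβ j)
    exact hij (hinj (sub_eq_zero.mp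
      ((Real.sin_eq_zero_iff_of_lt_of_lt (by linarith) (by linarith)).mp e)))
  rw [Finset.sum_eq_single j (fun i _ hij => by rw [h4 i hij]; simp) (by simp)] at hw
  rcases mul_eq_zero.mp hw with h5 | h5
  · rw [hω] at h5
    exact mul_ne_zero (ofReal_ne_zero.mpr (hρ j).ne') (exp_ne_zero _) h5
  · exact hj (by exact_mod_cast h5)

theorem mul_cos_nonneg_of_expansionCoeff_ne_zero {b x : ℝ} (hb : |b - θ| < Real.pi / 2)
    (hx : x ∈ Set.Icc θ (θ + 2 * Real.pi)) {m : ℤ} (h : expansionCoeff (InSector b x) m ≠ 0) :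
    0 ≤ (m : ℝ) * Real.cos (b - x) := by
  have hb' := abs_lt.mp hb
  have hx1 := hx.1
  have hx2 := hx.2
  by_cases hP : InSector b x
  · rw [expansionCoeff_of_true hP] at h
    have hm : 1 ≤ m := by by_contra h1; simp [h1] at h
    have hm' : (1 : ℝ) ≤ m := by exact_mod_cast hm
    refine mul_nonneg (by linarith) ?_
    rcases hP with h1 | h1
    · exact Real.cos_nonneg_of_mem_Icc ⟨by linarith, by linarith⟩
    · rw [← Real.cos_add_two_pi]
      exact Real.cos_nonneg_of_mem_Icc ⟨by linarith, by linarith⟩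
  · rw [expansionCoeff_of_false hP] at h
    have hm : m ≤ 0 := by by_contra h1; simp [h1] at h
    have hm' : (m : ℝ) ≤ 0 := by exact_mod_cast hm
    refine mul_nonneg_of_nonpos_of_nonpos hm' ?_
    simp only [InSector, not_or, not_le, not_lt] at hP
    rw [← Real.cos_neg]
    exact Real.cos_nonpos_of_pi_div_two_le_of_le (by linarith) (by linarith)

open Filter in
theorem eventually_cpowAround_eq (hω : ∀ j, ω j = ρ j * exp (β j * I)) (hρ : ∀ j, 0 < ρ j)
    (hβ : ∀ j, |β j - θ| < Real.pi / 2) (hinj : Function.Injective β) {m : Fin n → ℤ} (hm : m ≠ 0)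
    {x : ℝ} (h : ∀ j, 0 ≤ (m j : ℝ) * Real.cos (β j - x)) (s : ℂ) :
    ∀ᶠ y in 𝓝 x, cpowAround y (∑ j, ω j * (m j : ℂ)) s =
      cpowAround x (∑ j, ω j * (m j : ℂ)) s := by
  refine (eventually_logAround_eq (sum_ne_zero_of_cos_nonneg hω hρ hβ hinj hm h) ?_).mono
    fun y hy => by rw [cpowAround, cpowAround, hy]
  rw [re_sum_mul_exp hω]
  exact Finset.sum_nonneg fun j _ => mul_nonneg (hρ j).le (h j)

open Filter in
/-- If the coefficients of `sectorTerm` are constant near `x` on one side, so is `sectorTerm`. -/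
theorem eventually_sectorTerm_eq (hω : ∀ j, ω j = ρ j * exp (β j * I)) (hρ : ∀ j, 0 < ρ j)
    (hβ : ∀ j, |β j - θ| < Real.pi / 2) (hinj : Function.Injective β) {m : Fin n → ℤ} (hm : m ≠ 0)
    {x : ℝ} (hx : x ∈ Set.Icc θ (θ + 2 * Real.pi)) (s : ℂ) {S : Set ℝ}
    (h : ∀ j, ∀ᶠ y in 𝓝[S] x, InSector (β j) y ↔ InSector (β j) x) :
    ∀ᶠ y in 𝓝[S] x, sectorTerm β ω s m y = sectorTerm β ω s m x := by
  have h1 := eventually_all.mpr h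
  by_cases h0 : ∏ j, expansionCoeff (InSector (β j) x) (m j) = 0
  · filter_upwards [h1] with y hy
    simp only [sectorTerm, hy, h0, zero_mul]
  · have h2 := fun j => mul_cos_nonneg_of_expansionCoeff_ne_zero (hβ j) hx
      (Finset.prod_ne_zero_iff.mp h0 j (mem_univ j))
    filter_upwards [h1,
      nhdsWithin_le_nhds (eventually_cpowAround_eq hω hρ hβ hinj hm h2 (-s))] with y hy hy2
    simp only [sectorTerm, hy, hy2]

theorem crossing_mem {b : ℝ} (hb : |b - θ| < Real.pi / 2) {e : ℤ} (he : e = 1 ∨ e = -1) :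
    θ ≤ crossing b e ∧ crossing b e < θ + 2 * Real.pi := by
  have hb' := abs_lt.mp hb
  rcases he with rfl | rfl <;> simp only [crossing] <;> push_cast <;> constructor <;> linarith

theorem crossing_injective (hβ : ∀ j, |β j - θ| < Real.pi / 2) (hinj : Function.Injective β)
    {j k : Fin n} {e e' : ℤ} (he : e = 1 ∨ e = -1) (he' : e' = 1 ∨ e' = -1)
    (h : crossing (β j) e = crossing (β k) e') : j = k ∧ e = e' := by
  have hj := abs_lt.mp (hβ j)
  have hk := abs_lt.mp (hβ k)
  rcases he with rfl | rfl <;> rcases he' with rfl | rfl <;> simp only [crossing] at h <;>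
    push_cast at h
  · exact ⟨hinj (by linarith), rfl⟩
  · linarith
  · linarith
  · exact ⟨hinj (by linarith), rfl⟩

theorem inSector_crossing_iff (hω : ∀ j, ω j = ρ j * exp (β j * I)) (hρ : ∀ j, 0 < ρ j)
    (hβ : ∀ j, |β j - θ| < Real.pi / 2) (hinj : Function.Injective β) {j k : Fin n} (hjk : j ≠ k)
    {e : ℤ} (he : e = 1 ∨ e = -1) :
    InSector (β j) (crossing (β k) e) ↔ 0 < e * (ω j / ω k).im := by
  have hj := abs_lt.mp (hβ j)
  have hk := abs_lt.mp (hβ k)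
  have hr : 0 < ρ j / ρ k := div_pos (hρ j) (hρ k)
  rw [im_div_eq hω]
  rcases lt_or_gt_of_ne (hinj.ne hjk) with h1 | h1
  · have hs : Real.sin (β j - β k) < 0 :=
      Real.sin_neg_of_neg_of_neg_pi_lt (by linarith) (by linarith)
    have h2 := mul_neg_of_pos_of_neg hr hs
    rcases he with rfl | rfl <;> simp only [crossing, InSector] <;> push_cast
    · exact iff_of_false (by rintro (h | h) <;> linarith) (by linarith)
    · exact iff_of_true (Or.inr (by linarith)) (by linarith)
  · have hs : 0 < Real.sin (β j - β k) := Real.sin_pos_of_pos_of_lt_pi (by linarith) (by linarith)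
    have h2 := mul_pos hr hs
    rcases he with rfl | rfl <;> simp only [crossing, InSector] <;> push_cast
    · exact iff_of_true (Or.inl (by linarith)) (by linarith)
    · exact iff_of_false (by rintro (h | h) <;> linarith) (by linarith)

open Filter in
theorem eventually_sectorTerm_crossing (hω : ∀ j, ω j = ρ j * exp (β j * I)) (hρ : ∀ j, 0 < ρ j)
    (hβ : ∀ j, |β j - θ| < Real.pi / 2) (hinj : Function.Injective β) {m : Fin n → ℤ} (hm : m ≠ 0)
    (s : ℂ) (k : Fin n) {e : ℤ} (he : e = 1 ∨ e = -1) :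
    ∀ᶠ y in 𝓝[>] crossing (β k) e, sectorTerm β ω s m y =
      sectorTerm β ω s m (crossing (β k) e) + jumpTerm β ω s m k e := by
  set x := crossing (β k) e with hx
  have hxm := crossing_mem (hβ k) he
  have h1 : ∀ᶠ y in 𝓝[>] x, ∀ j, j ≠ k → (InSector (β j) y ↔ InSector (β j) x) := by
    rw [eventually_all]
    intro j
    by_cases hj : j = k
    · exact Eventually.of_forall fun y h => absurd hj h
    · refine (eventually_right_inSector fun e' he' h => hj ?_).mono fun y hy _ => hy
      exact (crossing_injective hβ hinj he he' h).1.symm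
  have h2 := eventually_right_crossing (β k) he (m k)
  rw [← hx] at h2
  have e1 : ∏ j ∈ univ.erase k, expansionCoeff (0 < e * (ω j / ω k).im) (m j) =
      ∏ j ∈ univ.erase k, expansionCoeff (InSector (β j) x) (m j) :=
    Finset.prod_congr rfl fun j hj => by
      rw [inSector_crossing_iff hω hρ hβ hinj (Finset.ne_of_mem_erase hj) he]
  have e2 : ∀ y, ∏ j, expansionCoeff (InSector (β j) y) (m j) =
      expansionCoeff (InSector (β k) y) (m k) *
        ∏ j ∈ univ.erase k, expansionCoeff (InSector (β j) y) (m j) := fun y =>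
    (Finset.mul_prod_erase univ _ (mem_univ k)).symm
  have e3 : ∀ y, (∀ j, j ≠ k → (InSector (β j) y ↔ InSector (β j) x)) →
      ∏ j ∈ univ.erase k, expansionCoeff (InSector (β j) y) (m j) =
        ∏ j ∈ univ.erase k, expansionCoeff (InSector (β j) x) (m j) := fun y hy =>
    Finset.prod_congr rfl fun j hj => by rw [hy j (Finset.ne_of_mem_erase hj)]
  by_cases h0 : ∏ j ∈ univ.erase k, expansionCoeff (InSector (β j) x) (m j) = 0
  · filter_upwards [h1] with y hy
    simp only [sectorTerm, jumpTerm, e1, e2, e3 y hy, h0, mul_zero, zero_mul, add_zero]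
  · have hcos : ∀ j, 0 ≤ (m j : ℝ) * Real.cos (β j - x) := by
      intro j
      by_cases hj : j = k
      · have : Real.cos (β j - x) = 0 := by
          rw [hj, hx, crossing]
          rcases he with rfl | rfl
          · rw [show β k - (β k + Real.pi - ((1 : ℤ) : ℝ) * (Real.pi / 2)) = -(Real.pi / 2) by
              push_cast; ring, Real.cos_neg, Real.cos_pi_div_two]
          · rw [show β k - (β k + Real.pi - ((-1 : ℤ) : ℝ) * (Real.pi / 2)) =
              Real.pi / 2 - 2 * Real.pi by push_cast; ring, Real.cos_sub_two_pi,
              Real.cos_pi_div_two]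
        rw [this, mul_zero]
      · exact mul_cos_nonneg_of_expansionCoeff_ne_zero (hβ j) ⟨hxm.1, hxm.2.le⟩
          (Finset.prod_ne_zero_iff.mp h0 j (Finset.mem_erase.mpr ⟨hj, mem_univ j⟩))
    filter_upwards [h1, h2,
      nhdsWithin_le_nhds (eventually_cpowAround_eq hω hρ hβ hinj hm hcos (-s))] with y hy hy2 hy3
    simp only [sectorTerm, jumpTerm, e1, e2, e3 y hy, hy2, hy3, ← hx]
    ring

/-- As `x` runs from `θ` to `θ + 2π`, the term of the lattice point `m ≠ 0` returns to itself up to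
the factor `e ^ (-2πis)`, and the difference is the sum of its jumps. -/
theorem exp_sub_one_mul_sectorTerm (hω : ∀ j, ω j = ρ j * exp (β j * I)) (hρ : ∀ j, 0 < ρ j)
    (hβ : ∀ j, |β j - θ| < Real.pi / 2) (hinj : Function.Injective β) {m : Fin n → ℤ} (hm : m ≠ 0)
    (s : ℂ) :
    (exp (-(2 * Real.pi * I * s)) - 1) * sectorTerm β ω s m θ =
      ∑ k, (jumpTerm β ω s m k 1 + jumpTerm β ω s m k (-1)) := by
  have hpi := Real.pi_pos
  have h := sub_eq_sum_jumps (a := θ) (b := θ + 2 * Real.pi) (by linarith)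
    (κ := Fin n × Bool) (p := fun q => crossing (β q.1) (if q.2 then 1 else -1))
    (J := fun q => jumpTerm β ω s m q.1 (if q.2 then 1 else -1)) (f := sectorTerm β ω s m)
    ?_ ?_ ?_ ?_ ?_
  · have e : sectorTerm β ω s m (θ + 2 * Real.pi) =
        exp (-(2 * Real.pi * I * s)) * sectorTerm β ω s m θ := by
      have e1 : ∀ j, InSector (β j) (θ + 2 * Real.pi) ↔ InSector (β j) θ := fun j => by
        have hj := abs_lt.mp (hβ j)
        exact iff_of_true (Or.inr (by linarith)) (Or.inl (by linarith))
      simp only [sectorTerm, e1, cpowAround, logAround_add_two_pi]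
      rw [mul_add, exp_add, show -s * (2 * Real.pi * I) = -(2 * Real.pi * I * s) by ring]
      ring
    rw [sub_mul, one_mul, ← e, h, Fintype.sum_prod_type]
    simp
  · rintro ⟨j, b⟩ ⟨k, b'⟩ hjk
    obtain ⟨h1, h2⟩ := crossing_injective hβ hinj
      (by cases b <;> simp) (by cases b' <;> simp) hjk
    have h1' : j = k := h1
    subst h1'
    cases b <;> cases b' <;> simp at h2 ⊢
  · rintro ⟨j, b⟩
    exact crossing_mem (hβ j) (by cases b <;> simp)
  · intro x hx
    exact eventually_sectorTerm_eq hω hρ hβ hinj hm hx s fun j => eventually_left_inSector _ _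
  · intro x hx hxp
    refine eventually_sectorTerm_eq hω hρ hβ hinj hm ⟨hx.1, hx.2.le⟩ s fun j =>
      eventually_right_inSector fun e he hxe => hxp ?_
    rcases he with rfl | rfl
    · exact ⟨(j, true), by simp [hxe]⟩
    · exact ⟨(j, false), by simp [hxe]⟩
  · rintro ⟨k, b⟩
    exact eventually_sectorTerm_crossing hω hρ hβ hinj hm s k (by cases b <;> simp)

end

/-! ### Evaluation of the jumps -/

section

variable {n : ℕ} {θ : ℝ} {ω : Fin n → ℂ} {ρ β : Fin n → ℝ}

theorem exp_crossing_mul_I (b : ℝ) {e : ℤ} (he : e = 1 ∨ e = -1) :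
    exp (crossing b e * I) = e * I * exp (b * I) := by
  rcases he with rfl | rfl
  · have : (crossing b 1 : ℂ) * I = Real.pi / 2 * I + b * I := by
      simp only [crossing]; push_cast; ring
    rw [this, exp_add, exp_pi_div_two_mul_I]
    simp
  · have : (crossing b (-1) : ℂ) * I = Real.pi * I + (Real.pi / 2 * I + b * I) := by
      simp only [crossing]; push_cast; ring
    rw [this, exp_add, exp_add, exp_pi_div_two_mul_I, exp_pi_mul_I]
    simp

theorem cpowAround_crossing {z : ℂ} {r b : ℝ} (hz : z = r * exp (b * I)) (hr : 0 < r) {e : ℤ}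
    (he : e = 1 ∨ e = -1) {u : ℂ} (hu : u ≠ 0) (s : ℂ) :
    cpowAround (crossing b e) (e * z * u) (-s) =
      exp (s * (Real.log (2 * Real.pi / r) - crossing b e * I)) *
        (-2 * Real.pi * I * u) ^ (-s) := by
  have hpi := Real.pi_pos
  have hv : -2 * Real.pi * I * u ≠ 0 := by
    simp [Real.pi_ne_zero, hu]
  have h1 : e * z * u * exp (-((crossing b e : ℂ) * I)) =
      ((r / (2 * Real.pi) : ℝ) : ℂ) * (-2 * Real.pi * I * u) := by
    rw [exp_neg, exp_crossing_mul_I b he, hz]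
    have hpc : (Real.pi : ℂ) ≠ 0 := ofReal_ne_zero.mpr Real.pi_ne_zero
    have hec : (e : ℂ) ≠ 0 := by rcases he with rfl | rfl <;> simp
    push_cast
    have hI := I_sq
    field_simp
    linear_combination (r : ℂ) * hI
  have h2 : Real.log (2 * Real.pi / r) = -Real.log (r / (2 * Real.pi)) := by
    rw [← Real.log_inv, inv_div]
  rw [cpowAround, logAround, h1, log_ofReal_mul (by positivity) hv, cpow_def_of_ne_zero hv,
    ← exp_add, h2]
  congr 1
  push_cast
  ring

theorem exp_log_add_crossing {z : ℂ} {r b : ℝ} (hz : z = r * exp (b * I)) (hr : 0 < r) {e : ℤ}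
    (he : e = 1 ∨ e = -1) :
    exp (Real.log (2 * Real.pi / r) + (2 * Real.pi - crossing b e : ℝ) * I) =
      -e * 2 * Real.pi * I * z⁻¹ := by
  have hpi := Real.pi_pos
  have e1 : ((2 * Real.pi - crossing b e : ℝ) : ℂ) * I =
      2 * Real.pi * I + -((crossing b e : ℂ) * I) := by push_cast; ring
  rw [exp_add, ← ofReal_exp, Real.exp_log (by positivity), e1, exp_add, exp_two_pi_mul_I, exp_neg,
    exp_crossing_mul_I b he, hz]
  have hrc : (r : ℂ) ≠ 0 := ofReal_ne_zero.mpr hr.ne'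
  push_cast
  have hI := I_sq
  rcases he with rfl | rfl
  · push_cast
    field_simp
    linear_combination hI
  · push_cast
    field_simp
    linear_combination (-1 : ℂ) * hI

theorem tPow_crossing {z : ℂ} {r b : ℝ} (hz : z = r * exp (b * I)) (hr : 0 < r)
    (hb : |b - θ| < Real.pi / 2) {e : ℤ} (he : e = 1 ∨ e = -1) {x : ℝ} (hx : 0 < x) (s : ℂ) :
    tPow θ (x * (-e * 2 * Real.pi * I * z⁻¹)) s = (x : ℂ) ^ s *
      exp (s * (Real.log (2 * Real.pi / r) + (2 * Real.pi - crossing b e : ℝ) * I)) := by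
  have hpi := Real.pi_pos
  have hc := crossing_mem hb he
  have e1 : (x : ℂ) * (-e * 2 * Real.pi * I * z⁻¹) = ((x * (2 * Real.pi / r) : ℝ) : ℂ) *
      exp ((2 * Real.pi - crossing b e : ℝ) * I) := by
    rw [← exp_log_add_crossing hz hr he, exp_add, ← ofReal_exp, Real.exp_log (by positivity)]
    push_cast
    ring
  rw [tPow, cpowAround, e1, logAround_mul_exp (by positivity) (by linarith) (by linarith),
    Real.log_mul hx.ne' (by positivity), cpow_def_of_ne_zero (ofReal_ne_zero.mpr hx.ne'),
    ← ofReal_log hx.le, ← exp_add]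
  congr 1
  push_cast
  ring

/-- The numbers `e ω_j / ω_k` for `j ≠ k`. -/
def ratios (ω : Fin n → ℂ) (k : Fin n) (e : ℤ) (j : {j : Fin n // j ≠ k}) : ℂ :=
  e * (ω j / ω k)

theorem prod_erase_eq_prod_ne (k : Fin n) (f : Fin n → ℂ) :
    ∏ j ∈ univ.erase k, f j = ∏ j : {j : Fin n // j ≠ k}, f j :=
  Finset.prod_subtype _ (by simp) f

theorem card_ne (k : Fin n) : (Fintype.card {j : Fin n // j ≠ k} : ℝ) + 1 = n := by
  have : 1 ≤ n := Nat.one_le_iff_ne_zero.mpr (by rintro rfl; exact k.elim0)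
  rw [Fintype.card_subtype_compl]
  simp [Nat.cast_sub this]

open Classical in
/-- Dividing by `e ω_k` turns the jumps into the terms of a lattice sum in the upper half plane,
with the principal value of the power. -/
theorem exists_equiv_jumpTerm (hω : ∀ j, ω j = ρ j * exp (β j * I)) (hρ : ∀ j, 0 < ρ j)
    (s : ℂ) (k : Fin n) {e : ℤ} (he : e = 1 ∨ e = -1) (him : ∀ j, (ratios ω k e j).im ≠ 0) :
    ∃ Φ : ({j : Fin n // j ≠ k} → ℤ) × ℤ ≃ (Fin n → ℤ), ∀ p,
      (if Φ p = 0 then 0 else jumpTerm β ω s (Φ p) k e) =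
        -e * exp (s * (Real.log (2 * Real.pi / ρ k) - crossing (β k) e * I)) *
        (if p = 0 then 0 else latticeCoeff (ratios ω k e) p.1 *
          (-2 * Real.pi * I * (p.2 + ∑ i, (p.1 i : ℂ) * ratios ω k e i)) ^ (-s)) := by
  obtain ⟨E, hE⟩ : ∃ E : ℤ ≃ ℤ, ∀ l, E l = e * l := by
    rcases he with rfl | rfl
    · exact ⟨Equiv.refl ℤ, fun l => by simp⟩
    · exact ⟨Equiv.neg ℤ, fun l => by simp⟩
  have he0 : e ≠ 0 := by rcases he with rfl | rfl <;> simp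
  have hee : (e : ℂ) * e = 1 := by rcases he with rfl | rfl <;> simp
  have hk0 : ω k ≠ 0 := by
    rw [hω]; exact mul_ne_zero (ofReal_ne_zero.mpr (hρ k).ne') (exp_ne_zero _)
  set Φ := ((Equiv.prodCongr (Equiv.refl ({j : Fin n // j ≠ k} → ℤ)) E).trans
    (Equiv.prodComm _ _)).trans (Equiv.funSplitAt k ℤ).symm with hΦ
  have hΦk : ∀ p, Φ p k = e * p.2 := fun p => by
    simp [hΦ, Equiv.funSplitAt, Equiv.piSplitAt, hE]
  have hΦj : ∀ p (j : {j : Fin n // j ≠ k}), Φ p j = p.1 j := fun p j => by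
    simp [hΦ, Equiv.funSplitAt, Equiv.piSplitAt, j.2]
  have hΦ0 : ∀ p, Φ p = 0 ↔ p = 0 := fun p => by
    have : Φ 0 = 0 := by
      funext j
      by_cases hj : j = k
      · rw [hj, hΦk]; simp
      · exact hΦj 0 ⟨j, hj⟩
    rw [← Φ.injective.eq_iff (a := p) (b := 0), this]
  refine ⟨Φ, fun p => ?_⟩
  by_cases hp : p = 0
  · rw [if_pos ((hΦ0 p).mpr hp), if_pos hp, mul_zero]
  rw [if_neg (mt (hΦ0 p).mp hp), if_neg hp]
  have e1 : ∏ j ∈ univ.erase k, expansionCoeff (0 < e * (ω j / ω k).im) (Φ p j) =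
      latticeCoeff (ratios ω k e) p.1 := by
    rw [prod_erase_eq_prod_ne, latticeCoeff]
    refine Finset.prod_congr rfl fun j _ => ?_
    rw [hΦj]
    have : (ratios ω k e j).im = e * (ω j / ω k).im := by simp [ratios]
    rw [this]
  have e2 : ∑ j, ω j * (Φ p j : ℂ) =
      e * ω k * (p.2 + ∑ i, (p.1 i : ℂ) * ratios ω k e i) := by
    rw [Fintype.sum_eq_add_sum_subtype_ne _ k, mul_add, hΦk, Finset.mul_sum]
    push_cast
    congr 1
    · ring
    · refine Finset.sum_congr rfl fun j _ => ?_
      rw [hΦj, ratios]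
      have : e * ω k * (p.1 j * (e * (ω j / ω k))) = (e * e : ℂ) * (p.1 j * (ω j / ω k * ω k)) := by
        ring
      rw [this, hee, div_mul_cancel₀ _ hk0]
      ring
  rw [jumpTerm, e1, e2]
  by_cases h0 : latticeCoeff (ratios ω k e) p.1 = 0
  · simp [h0]
  obtain ⟨c, hc, hle⟩ := exists_mul_sum_abs_le_norm him
  have hu : (p.2 : ℂ) + ∑ i, (p.1 i : ℂ) * ratios ω k e i ≠ 0 := by
    intro hu
    have h1 := hle p.1 p.2 h0
    rw [hu, norm_zero] at h1
    have h2 : |(p.2 : ℝ)| + ∑ i, |(p.1 i : ℝ)| ≤ 0 := by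
      by_contra h3
      exact absurd h1 (not_le.mpr (mul_pos hc (not_le.mp h3)))
    have h3 : 0 ≤ ∑ i, |(p.1 i : ℝ)| := Finset.sum_nonneg fun _ _ => abs_nonneg _
    have h4 := abs_nonneg (p.2 : ℝ)
    refine hp (Prod.ext ?_ ?_)
    · by_contra h5
      have := one_le_sum_abs_of_ne_zero h5
      linarith
    · have : |(p.2 : ℝ)| = 0 := by linarith
      simpa using this
  rw [cpowAround_crossing (hω k) (hρ k) he hu]
  ring

open Classical in
/-- The jumps across one boundary ray, summed over the lattice, are the contribution of the
corresponding ray `t ∈ -2πi e ω_k⁻¹ ℝ_{>0}` of poles of `∏ 1 / (e ^ (ω_j t) - 1)`. -/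
theorem summable_jumpTerm_and_gamma_mul_tsum (hn : 2 ≤ n)
    (hω : ∀ j, ω j = ρ j * exp (β j * I)) (hρ : ∀ j, 0 < ρ j)
    (hβ : ∀ j, |β j - θ| < Real.pi / 2) {s : ℂ}
    (hs : (n : ℝ) < s.re) (k : Fin n) {e : ℤ} (he : e = 1 ∨ e = -1)
    (him : ∀ j, (ratios ω k e j).im ≠ 0) :
    (Summable fun m : Fin n → ℤ => if m = 0 then 0 else jumpTerm β ω s m k e) ∧
    Gamma s * ∑' m : Fin n → ℤ, (if m = 0 then 0 else jumpTerm β ω s m k e) =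
      2 * Real.pi * I * exp (-(2 * Real.pi * I * s)) * ((ω k)⁻¹ *
        (∑' r : ℕ+, tPow θ (((r : ℕ) : ℝ) * (-e * 2 * Real.pi * I * (ω k)⁻¹)) (s - 1) *
          residueFactor (ratios ω k e) r +
        latticeCoeff (ratios ω k e) 0 *
          tPow θ ((1 : ℝ) * (-e * 2 * Real.pi * I * (ω k)⁻¹)) (s - 1) * riemannZeta (1 - s))) := by
  have hn' : (2 : ℝ) ≤ n := by exact_mod_cast hn
  obtain ⟨Φ, hΦ⟩ := exists_equiv_jumpTerm (β := β) hω hρ s k he him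
  have hsum := summable_latticeCoeff_mul_cpow him (s := s) (by rw [card_ne]; exact hs)
  rw [← Φ.summable_iff, ← Φ.tsum_eq]
  simp only [Function.comp_def, hΦ]
  refine ⟨hsum.mul_left _, ?_⟩
  rw [tsum_mul_left, mul_left_comm, gamma_mul_tsum_latticeCoeff him (by linarith) hsum]
  have hee : (e : ℂ) * e = 1 := by rcases he with rfl | rfl <;> simp
  have e1 : ∀ r : ℕ+, tPow θ (((r : ℕ) : ℝ) * (-e * 2 * Real.pi * I * (ω k)⁻¹)) (s - 1) *
      residueFactor (ratios ω k e) r =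
      exp ((s - 1) * (Real.log (2 * Real.pi / ρ k) +
        (2 * Real.pi - crossing (β k) e : ℝ) * I)) *
        ((r : ℂ) ^ (s - 1) * residueFactor (ratios ω k e) r) := fun r => by
    rw [tPow_crossing (hω k) (hρ k) (hβ k) he (by exact_mod_cast r.pos)]
    push_cast
    ring
  simp only [e1]
  rw [tsum_mul_left, tPow_crossing (hω k) (hρ k) (hβ k) he one_pos, ofReal_one, one_cpow]
  have e2 : exp (s * (Real.log (2 * Real.pi / ρ k) - crossing (β k) e * I)) =
      exp (-(2 * Real.pi * I * s)) * (exp ((s - 1) * (Real.log (2 * Real.pi / ρ k) +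
        (2 * Real.pi - crossing (β k) e : ℝ) * I)) * (-e * 2 * Real.pi * I * (ω k)⁻¹)) := by
    rw [← exp_log_add_crossing (hω k) (hρ k) he, ← exp_add, ← exp_add]
    congr 1
    push_cast
    ring
  rw [e2]
  linear_combination (2 * Real.pi * I * (ω k)⁻¹ * exp (-(2 * Real.pi * I * s)) *
    exp ((s - 1) * (Real.log (2 * Real.pi / ρ k) + (2 * Real.pi - crossing (β k) e : ℝ) * I)) *
    (∑' r : ℕ+, (r : ℂ) ^ (s - 1) * residueFactor (ratios ω k e) r +
        latticeCoeff (ratios ω k e) 0 * riemannZeta (1 - s))) * hee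

theorem latticeCoeff_ratios_zero (k : Fin n) (e : ℤ) (J : Set (Fin n))
    (hJ : ∀ j, j ∈ J ↔ j ≠ k ∧ 0 < (e * (ω j / ω k)).im) :
    latticeCoeff (ratios ω k e) 0 = delta J := by
  classical
  have hn : 1 ≤ n := Nat.one_le_iff_ne_zero.mpr (by rintro rfl; exact k.elim0)
  rw [latticeCoeff, delta]
  split_ifs with h
  · have : ∀ j, expansionCoeff (0 < (ratios ω k e j).im) 0 = -1 := fun j => by
      rw [expansionCoeff_of_false, if_pos le_rfl]
      intro h1
      have : (j : Fin n) ∈ J := (hJ j).mpr ⟨j.2, h1⟩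
      simp [h] at this
    simp only [Pi.zero_apply, this, Finset.prod_const, Finset.card_univ]
    rw [Fintype.card_subtype_compl]
    obtain ⟨l, rfl⟩ : ∃ l, n = l + 1 := ⟨n - 1, by omega⟩
    simp [pow_succ]
  · obtain ⟨j, hj⟩ := Set.nonempty_iff_ne_empty.mpr h
    obtain ⟨h1, h2⟩ := (hJ j).mp hj
    refine Finset.prod_eq_zero (mem_univ ⟨j, h1⟩) ?_
    rw [expansionCoeff_of_true (by exact h2)]
    simp

theorem latticeCoeff_ratios_one (ω : Fin n → ℂ) (k : Fin n) :
    latticeCoeff (ratios ω k 1) 0 = delta (indexPos ω k) :=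
  latticeCoeff_ratios_zero k 1 _ fun j => by simp [indexPos]

theorem latticeCoeff_ratios_neg_one (ω : Fin n → ℂ) (k : Fin n) :
    latticeCoeff (ratios ω k (-1)) 0 = delta (indexNeg ω k) :=
  latticeCoeff_ratios_zero k (-1) _ fun j => by simp [indexNeg]

theorem termNeg_eq (θ : ℝ) (ω : Fin n → ℂ) (k : Fin n) (r : ℕ+) (s : ℂ) :
    termNeg θ ω k r s =
      tPow θ (((r : ℕ) : ℝ) * (-((1 : ℤ) : ℂ) * 2 * Real.pi * I * (ω k)⁻¹)) (s - 1) *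
        residueFactor (ratios ω k 1) r := by
  rw [termNeg, residueFactor, latticeCoeff_ratios_one,
    prod_erase_eq_prod_ne]
  congr 2
  · push_cast; ring
  · refine Finset.prod_congr rfl fun j _ => ?_
    simp only [ratios]
    congr 3
    push_cast
    ring

theorem termPos_eq (θ : ℝ) (ω : Fin n → ℂ) (k : Fin n) (r : ℕ+) (s : ℂ) :
    termPos θ ω k r s =
      tPow θ (((r : ℕ) : ℝ) * (-((-1 : ℤ) : ℂ) * 2 * Real.pi * I * (ω k)⁻¹)) (s - 1) *
        residueFactor (ratios ω k (-1)) r := by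
  rw [termPos, residueFactor, latticeCoeff_ratios_neg_one,
    prod_erase_eq_prod_ne]
  congr 2
  · push_cast; ring
  · refine Finset.prod_congr rfl fun j _ => ?_
    simp only [ratios]
    congr 3
    push_cast
    ring

open Classical in
theorem tsum_dirichletTerm_eq (hβ : ∀ j, |β j - θ| < Real.pi / 2) (hn : 2 ≤ n) (s : ℂ) :
    ∑' m : Fin n → ℤ, (if m = 0 then 0 else sectorTerm β ω s m θ) =
      ∑' l : Fin n → ℕ, dirichletTerm θ (aPoint ω 0) ω s l := by
  have hP : ∀ j, InSector (β j) θ := fun j => Or.inl (by linarith [abs_lt.mp (hβ j)])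
  set g : (Fin n → ℕ) → Fin n → ℤ := fun l j => (l j : ℤ) + 1 with hg
  have hginj : Function.Injective g := fun a b h => funext fun j => by
    have := congrFun h j
    simpa [hg] using this
  rw [← hginj.tsum_eq]
  · refine tsum_congr fun l => ?_
    have h0 : g l ≠ 0 := fun h => by
      have := congrFun h ⟨0, by omega⟩
      simp [hg] at this
      omega
    rw [if_neg h0, sectorTerm, Finset.prod_eq_one, one_mul, dirichletTerm, aPoint,
      ← Finset.sum_add_distrib]
    · congr 1
      refine Finset.sum_congr rfl fun j _ => ?_
      simp only [hg]
      push_cast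
      ring
    · intro j _
      rw [expansionCoeff_of_true (hP j), if_pos]
      simp [hg]
  · intro m hm
    rw [Function.mem_support] at hm
    by_cases h0 : m = 0
    · simp [h0] at hm
    rw [if_neg h0, sectorTerm] at hm
    have h1 := Finset.prod_ne_zero_iff.mp (left_ne_zero_of_mul hm)
    refine ⟨fun j => (m j - 1).toNat, funext fun j => ?_⟩
    have h2 := h1 j (mem_univ j)
    rw [expansionCoeff_of_true (hP j)] at h2
    have h3 : 1 ≤ m j := by by_contra h3; simp [h3] at h2
    simp only [hg]
    omega

/-- The formula in the half plane where the multiple Dirichlet series converges. -/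
theorem tsum_dirichletTerm_eq_funcEqRHS (hn : 2 ≤ n)
    (hω : ∀ j, ω j = ρ j * exp (β j * I)) (hρ : ∀ j, 0 < ρ j)
    (hβ : ∀ j, |β j - θ| < Real.pi / 2) (hinj : Function.Injective β)
    (him : ∀ j k, j ≠ k → (ω j / ω k).im ≠ 0) {s : ℂ}
    (hs : (n : ℝ) < s.re) (hsZ : ∀ l : ℤ, s ≠ l) :
    ∑' l : Fin n → ℕ, dirichletTerm θ (aPoint ω 0) ω s l = funcEqRHS θ ω s := by
  classical
  have him1 : ∀ k j, (ratios ω k 1 j).im ≠ 0 := fun k j => by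
    simpa [ratios] using him j k j.2
  have him2 : ∀ k j, (ratios ω k (-1) j).im ≠ 0 := fun k j => by
    simpa [ratios] using him j k j.2
  have h1 := fun k => summable_jumpTerm_and_gamma_mul_tsum hn hω hρ hβ hs k
    (Or.inl rfl) (him1 k)
  have h2 := fun k => summable_jumpTerm_and_gamma_mul_tsum hn hω hρ hβ hs k
    (Or.inr rfl) (him2 k)
  have hΓ : Gamma s ≠ 0 := Gamma_ne_zero fun m h => hsZ (-(m : ℤ)) (by rw [h]; push_cast; ring)
  have hE : exp (2 * Real.pi * I * s) ≠ 1 := by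
    intro h
    obtain ⟨l, hl⟩ := exp_eq_one_iff.mp h
    exact hsZ l (mul_left_cancel₀ two_pi_I_ne_zero (hl.trans (mul_comm _ _)))
  set D := ∑' l : Fin n → ℕ, dirichletTerm θ (aPoint ω 0) ω s l with hD
  have key : (exp (-(2 * Real.pi * I * s)) - 1) * D =
      ∑ k, ((∑' m : Fin n → ℤ, if m = 0 then 0 else jumpTerm β ω s m k 1) +
        ∑' m : Fin n → ℤ, if m = 0 then 0 else jumpTerm β ω s m k (-1)) := by
    rw [hD, ← tsum_dirichletTerm_eq hβ hn s, ← tsum_mul_left]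
    have e1 : ∀ m : Fin n → ℤ, (exp (-(2 * Real.pi * I * s)) - 1) *
        (if m = 0 then 0 else sectorTerm β ω s m θ) =
        ∑ k, ((if m = 0 then 0 else jumpTerm β ω s m k 1) +
          if m = 0 then 0 else jumpTerm β ω s m k (-1)) := fun m => by
      by_cases hm : m = 0
      · simp [hm]
      · simp only [hm, if_false]
        exact exp_sub_one_mul_sectorTerm hω hρ hβ hinj hm s
    simp only [e1]
    rw [Summable.tsum_finsetSum fun k _ => (h1 k).1.add (h2 k).1]
    exact Finset.sum_congr rfl fun k _ => (h1 k).1.tsum_add (h2 k).1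
  have key2 : Gamma s * ((exp (-(2 * Real.pi * I * s)) - 1) * D) =
      2 * Real.pi * I * exp (-(2 * Real.pi * I * s)) * ∑ k, (ω k)⁻¹ *
      ((∑' m : ℕ+, termPos θ ω k m s) + (∑' m : ℕ+, termNeg θ ω k m s) +
        delta (indexNeg ω k) * tPow θ (2 * Real.pi * I * (ω k)⁻¹) (s - 1) *
          riemannZeta (1 - s) +
        delta (indexPos ω k) * tPow θ (-2 * Real.pi * I * (ω k)⁻¹) (s - 1) *
          riemannZeta (1 - s)) := by
    rw [key, Finset.mul_sum, Finset.mul_sum]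
    refine Finset.sum_congr rfl fun k _ => ?_
    rw [mul_add, (h1 k).2, (h2 k).2, latticeCoeff_ratios_one, latticeCoeff_ratios_neg_one]
    simp only [← termPos_eq, ← termNeg_eq]
    have e1 : ((1 : ℝ) : ℂ) * (-((1 : ℤ) : ℂ) * 2 * Real.pi * I * (ω k)⁻¹) =
        -2 * Real.pi * I * (ω k)⁻¹ := by push_cast; ring
    have e2 : ((1 : ℝ) : ℂ) * (-((-1 : ℤ) : ℂ) * 2 * Real.pi * I * (ω k)⁻¹) =
        2 * Real.pi * I * (ω k)⁻¹ := by push_cast; ring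
    rw [e1, e2]
    ring
  rw [funcEqRHS]
  rw [exp_neg] at key2
  have hE0 := exp_ne_zero (2 * Real.pi * I * s)
  have hE1 : exp (2 * Real.pi * I * s) - 1 ≠ 0 := sub_ne_zero.mpr hE
  set q := exp (2 * Real.pi * I * s)
  have key3 : Gamma s * ((1 - q) * D) = q * (Gamma s * ((q⁻¹ - 1) * D)) := by
    field_simp
  rw [key2, mul_comm (2 * Real.pi * I) q⁻¹, mul_assoc, mul_inv_cancel_left₀ hE0] at key3
  have hne : Gamma s * (q - 1) ≠ 0 := mul_ne_zero hΓ hE1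
  rw [← neg_div, div_mul_eq_mul_div, eq_div_iff hne]
  linear_combination -key3

end

/-! ### Meromorphic continuation -/

section

variable {n : ℕ} {θ : ℝ} {ω : Fin n → ℂ} {ρ β : Fin n → ℝ}

theorem exists_polar (hω : ∀ j, ω j ∈ halfPlane θ) (him : ∀ j k, j ≠ k → (ω j / ω k).im ≠ 0) :
    ∃ ρ β : Fin n → ℝ, (∀ j, ω j = ρ j * exp (β j * I)) ∧ (∀ j, 0 < ρ j) ∧
      (∀ j, |β j - θ| < Real.pi / 2) ∧ Function.Injective β := by
  choose r φ hr h1 h2 h3 using hω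
  have h4 : ∀ j, ω j = r j * exp ((θ + φ j : ℝ) * I) := h3
  refine ⟨r, fun j => θ + φ j, h4, hr, fun j => ?_, fun j k hjk => ?_⟩
  · rw [add_sub_cancel_left]
    exact abs_lt.mpr ⟨h1 j, h2 j⟩
  · by_contra hne
    have h5 : θ + φ j = θ + φ k := hjk
    refine him j k hne ?_
    rw [im_div_eq (β := fun j => θ + φ j) h4, h5, sub_self, Real.sin_zero, mul_zero]

theorem norm_cpowAround_neg_le (c : ℝ) {z : ℂ} (hz : z ≠ 0) (s : ℂ) :
    ‖cpowAround c z (-s)‖ ≤ Real.exp (|s.im| * (Real.pi + |c|)) * ‖z‖ ^ (-s.re) := by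
  set v := z * exp (-((c : ℂ) * I)) with hv
  have hvz : ‖v‖ = ‖z‖ := by
    rw [hv, norm_mul, norm_exp]; simp
  have e : (-s * logAround c z).re = s.im * (v.arg + c) + Real.log ‖z‖ * (-s.re) := by
    rw [logAround, ← hv, mul_re]
    simp [log_re, log_im, hvz]
    ring
  rw [cpowAround, norm_exp, e, Real.exp_add, Real.rpow_def_of_pos (norm_pos_iff.mpr hz)]
  refine mul_le_mul_of_nonneg_right (Real.exp_le_exp.mpr ?_) (Real.exp_pos _).le
  calc s.im * (v.arg + c) ≤ |s.im * (v.arg + c)| := le_abs_self _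
    _ = |s.im| * |v.arg + c| := abs_mul _ _
    _ ≤ _ := mul_le_mul_of_nonneg_left
      ((abs_add_le _ _).trans (add_le_add_left (abs_arg_le_pi v) _)) (abs_nonneg _)

theorem differentiable_cpowAround (c : ℝ) (z : ℂ) : Differentiable ℂ (cpowAround c z) := by
  unfold cpowAround
  fun_prop

/-- A summable majorant of the multiple Dirichlet series, locally uniform in `Re s > n`. -/
theorem exists_bound_dirichletTerm (hn : 2 ≤ n) (hω : ∀ j, ω j = ρ j * exp (β j * I))
    (hρ : ∀ j, 0 < ρ j) (hβ : ∀ j, |β j - θ| < Real.pi / 2) {σ₀ : ℝ} (hσ : (n : ℝ) < σ₀) (R : ℝ) :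
    ∃ u : (Fin n → ℕ) → ℝ, Summable u ∧ ∀ l s, σ₀ ≤ s.re → ‖s‖ ≤ R →
      ‖dirichletTerm θ (aPoint ω 0) ω s l‖ ≤ u l := by
  have : Nonempty (Fin n) := ⟨⟨0, by omega⟩⟩
  obtain ⟨j₀, hj₀⟩ := Finite.exists_min fun j => ρ j * Real.cos (β j - θ)
  have hcos : ∀ j, 0 < ρ j * Real.cos (β j - θ) := fun j =>
    mul_pos (hρ j) (Real.cos_pos_of_mem_Ioo (abs_lt.mp (hβ j)))
  set c := ρ j₀ * Real.cos (β j₀ - θ) with hc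
  have hc0 : 0 < c := hcos j₀
  set g : (Fin n → ℕ) → Fin n → ℤ := fun l j => (l j : ℤ) + 1 with hg
  have hginj : Function.Injective g := fun a b h => funext fun j => by
    have := congrFun h j
    simpa [hg] using this
  have hg1 : ∀ l j, (1 : ℝ) ≤ g l j := fun l j => by simp [hg]
  have hsumm := ((summable_norm_rpow_pi (ι := Fin n) (by simpa using hσ)).comp_injective
    hginj).mul_left (Real.exp (R * (Real.pi + |θ|)) * Real.exp (R * |Real.log c|))
  refine ⟨_, hsumm, fun l s hs hsR => ?_⟩
  set M := ‖(fun i => (g l i : ℝ) : Fin n → ℝ)‖ with hM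
  have hM1 : 1 ≤ M := by
    refine (hg1 l j₀).trans ((le_abs_self _).trans ?_)
    exact norm_le_pi_norm (fun i => (g l i : ℝ)) j₀
  have hw : c * M ≤ ‖∑ j, ω j * (g l j : ℂ)‖ := by
    have h1 := re_sum_mul_exp hω (g l) θ
    have h2 : ‖(∑ j, ω j * (g l j : ℂ)) * exp (-((θ : ℂ) * I))‖ = ‖∑ j, ω j * (g l j : ℂ)‖ := by
      rw [norm_mul, norm_exp]; simp
    rw [← h2]
    refine le_trans ?_ ((le_abs_self _).trans (abs_re_le_norm _))
    rw [h1]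
    refine (mul_le_mul_of_nonneg_left (norm_le_sum_abs (g l)) hc0.le).trans ?_
    rw [Finset.mul_sum]
    refine Finset.sum_le_sum fun j _ => ?_
    rw [abs_of_nonneg (by linarith [hg1 l j])]
    have := mul_le_mul_of_nonneg_right (hj₀ j) (show (0 : ℝ) ≤ g l j by linarith [hg1 l j])
    linarith
  have hwpos : 0 < ‖∑ j, ω j * (g l j : ℂ)‖ := lt_of_lt_of_le (by positivity) hw
  have e : dirichletTerm θ (aPoint ω 0) ω s l = cpowAround θ (∑ j, ω j * (g l j : ℂ)) (-s) := by
    rw [dirichletTerm, aPoint, ← Finset.sum_add_distrib]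
    congr 1
    refine Finset.sum_congr rfl fun j _ => ?_
    simp only [hg]
    push_cast
    ring
  have hn0 : (0 : ℝ) ≤ n := by positivity
  rw [e]
  refine (norm_cpowAround_neg_le θ (norm_pos_iff.mp hwpos) s).trans ?_
  rw [mul_assoc]
  refine mul_le_mul ?_ ?_ (by positivity) (by positivity)
  · refine Real.exp_le_exp.mpr (mul_le_mul_of_nonneg_right ?_ (by positivity))
    exact (abs_im_le_norm s).trans hsR
  · refine (Real.rpow_le_rpow_of_nonpos (by positivity) hw (by linarith)).trans ?_
    rw [Real.mul_rpow hc0.le (by positivity)]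
    refine mul_le_mul ?_ ?_ (by positivity) (by positivity)
    · rw [Real.rpow_def_of_pos hc0]
      refine Real.exp_le_exp.mpr ?_
      calc Real.log c * -s.re ≤ |Real.log c * -s.re| := le_abs_self _
        _ = |s.re| * |Real.log c| := by rw [abs_mul, abs_neg, mul_comm]
        _ ≤ _ := mul_le_mul_of_nonneg_right ((abs_re_le_norm s).trans hsR) (abs_nonneg _)
    · exact Real.rpow_le_rpow_of_exponent_le hM1 (by linarith)

theorem summable_and_analyticAt_dirichletTerm (hn : 2 ≤ n) (hω : ∀ j, ω j = ρ j * exp (β j * I))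
    (hρ : ∀ j, 0 < ρ j) (hβ : ∀ j, |β j - θ| < Real.pi / 2) {s : ℂ} (hs : (n : ℝ) < s.re) :
    Summable (dirichletTerm θ (aPoint ω 0) ω s) ∧
      AnalyticAt ℂ (fun z => ∑' l, dirichletTerm θ (aPoint ω 0) ω z l) s := by
  obtain ⟨u, hu, hle⟩ := exists_bound_dirichletTerm hn hω hρ hβ
    (show (n : ℝ) < (n + s.re) / 2 by linarith) (‖s‖ + 1)
  set U : Set ℂ := {z | (n + s.re) / 2 < z.re} ∩ Metric.ball 0 (‖s‖ + 1)
  have hU : IsOpen U := (isOpen_lt continuous_const continuous_re).inter Metric.isOpen_ball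
  have hsU : s ∈ U := ⟨show (n + s.re) / 2 < s.re by linarith, by simp⟩
  have hb : ∀ l, ∀ z ∈ U, ‖dirichletTerm θ (aPoint ω 0) ω z l‖ ≤ u l := fun l z hz =>
    hle l z (le_of_lt hz.1) (mem_ball_zero_iff.mp hz.2).le
  refine ⟨Summable.of_norm_bounded hu fun l => hb l s hsU, ?_⟩
  have hd := differentiableOn_tsum_of_summable_norm
    (F := fun l z => dirichletTerm θ (aPoint ω 0) ω z l) hu (fun l => ?_) hU hb
  · exact hd.analyticAt (hU.mem_nhds hsU)
  · exact ((differentiable_cpowAround θ _).comp differentiable_neg).differentiableOn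

/-- A summable majorant, uniform on bounded sets, of the series over a ray of poles. -/
theorem exists_bound_residueTerm (hω : ∀ j, ω j = ρ j * exp (β j * I))
    (hρ : ∀ j, 0 < ρ j) (hβ : ∀ j, |β j - θ| < Real.pi / 2) (k : Fin n)
    {e : ℤ} (he : e = 1 ∨ e = -1) (him : ∀ j, (ratios ω k e j).im ≠ 0) (R : ℝ) :
    ∃ u : ℕ+ → ℝ, Summable u ∧ ∀ (r : ℕ+) s, ‖s‖ ≤ R →
      ‖tPow θ (((r : ℕ) : ℝ) * (-e * 2 * Real.pi * I * (ω k)⁻¹)) (s - 1) *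
        residueFactor (ratios ω k e) r‖ ≤ u r := by
  obtain ⟨c, hc, K, hK, hle⟩ := exists_norm_residueFactor_le him
  set Λ : ℂ := Real.log (2 * Real.pi / ρ k) + (2 * Real.pi - crossing (β k) e : ℝ) * I
  refine ⟨_, (summable_rpow_mul_exp_neg R hc).mul_left (Real.exp ((R + 1) * ‖Λ‖) * K),
    fun r s hs => ?_⟩
  have hr : (1 : ℝ) ≤ (r : ℕ) := by exact_mod_cast (one_le (a := r))
  have hr0 : (0 : ℝ) < (r : ℕ) := by linarith
  rw [tPow_crossing (hω k) (hρ k) (hβ k) he hr0, norm_mul, norm_mul,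
    norm_cpow_eq_rpow_re_of_pos hr0]
  have h1 : ((r : ℕ) : ℝ) ^ (s - 1).re ≤ ((r : ℕ) : ℝ) ^ R := by
    refine Real.rpow_le_rpow_of_exponent_le hr ?_
    have := (le_abs_self s.re).trans ((abs_re_le_norm s).trans hs)
    simp
    linarith
  have h2 : ‖exp ((s - 1) * Λ)‖ ≤ Real.exp ((R + 1) * ‖Λ‖) := by
    refine (norm_exp_le_exp_norm _).trans (Real.exp_le_exp.mpr ?_)
    rw [norm_mul]
    refine mul_le_mul_of_nonneg_right ((norm_sub_le _ _).trans ?_) (norm_nonneg _)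
    rw [norm_one]
    linarith
  calc ((r : ℕ) : ℝ) ^ (s - 1).re * ‖exp ((s - 1) * Λ)‖ * ‖residueFactor (ratios ω k e) r‖
      ≤ ((r : ℕ) : ℝ) ^ R * Real.exp ((R + 1) * ‖Λ‖) * (K * Real.exp (-(c * (r : ℕ)))) :=
        mul_le_mul (mul_le_mul h1 h2 (norm_nonneg _) (by positivity)) (hle r) (norm_nonneg _)
          (by positivity)
    _ = _ := by ring

theorem absUnifOnCompacts_of_bound {f : ℕ+ → ℂ → ℂ}
    (h : ∀ R : ℝ, ∃ u : ℕ+ → ℝ, Summable u ∧ ∀ (r : ℕ+) s, ‖s‖ ≤ R → ‖f r s‖ ≤ u r) :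
    AbsUnifOnCompacts f := by
  intro K hK
  obtain ⟨R, hR⟩ := hK.isBounded.exists_norm_le
  obtain ⟨u, hu, hle⟩ := h R
  exact (HasSumUniformlyOn.of_norm_le_summable hu fun r s hs => by
    rw [norm_norm]; exact hle r s (hR s hs)).summableUniformlyOn

theorem differentiable_tsum_of_bound {f : ℕ+ → ℂ → ℂ} (hf : ∀ r, Differentiable ℂ (f r))
    (h : ∀ R : ℝ, ∃ u : ℕ+ → ℝ, Summable u ∧ ∀ (r : ℕ+) s, ‖s‖ ≤ R → ‖f r s‖ ≤ u r) :
    Differentiable ℂ fun s => ∑' r, f r s := by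
  intro s
  obtain ⟨u, hu, hle⟩ := h (‖s‖ + 1)
  have hd := differentiableOn_tsum_of_summable_norm (F := f) (U := Metric.ball 0 (‖s‖ + 1)) hu
    (fun r => (hf r).differentiableOn) Metric.isOpen_ball
    fun r z hz => hle r z (mem_ball_zero_iff.mp hz).le
  exact hd.differentiableAt (Metric.isOpen_ball.mem_nhds (by simp))

theorem differentiable_tPow_sub_one (θ : ℝ) (t : ℂ) :
    Differentiable ℂ fun s => tPow θ t (s - 1) :=
  (differentiable_cpowAround _ _).comp (differentiable_id.sub_const 1)

theorem meromorphicAt_riemannZeta (s : ℂ) : MeromorphicAt riemannZeta s := by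
  rcases eq_or_ne s 0 with rfl | hs
  · have hd : DifferentiableOn ℂ riemannZeta {1}ᶜ := fun z hz =>
      (differentiableAt_riemannZeta hz).differentiableWithinAt
    exact (hd.analyticAt (isOpen_compl_singleton.mem_nhds (by simp))).meromorphicAt
  have h0 : MeromorphicAt (fun z => (completedRiemannZeta₀ z - 1 / z - 1 / (1 - z)) *
      (Gammaℝ z)⁻¹) s :=
    ((((differentiable_completedZeta₀.analyticAt s).meromorphicAt).sub
      ((MeromorphicAt.const 1 s).div (MeromorphicAt.id s))).sub
      ((MeromorphicAt.const 1 s).div ((MeromorphicAt.const 1 s).sub (MeromorphicAt.id s)))).mul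
      (differentiable_Gammaℝ_inv.analyticAt s).meromorphicAt
  refine h0.congr (Filter.EventuallyEq.filter_mono ?_ nhdsWithin_le_nhds)
  filter_upwards [isOpen_compl_singleton.mem_nhds (show s ∈ ({0}ᶜ : Set ℂ) from hs)] with z hz
  rw [riemannZeta_def_of_ne_zero hz, completedRiemannZeta_eq, div_eq_mul_inv _ (Gammaℝ z)]

theorem differentiable_tsum_termPos_and_termNeg (hω : ∀ j, ω j = ρ j * exp (β j * I))
    (hρ : ∀ j, 0 < ρ j) (hβ : ∀ j, |β j - θ| < Real.pi / 2)
    (him : ∀ j k, j ≠ k → (ω j / ω k).im ≠ 0) (k : Fin n) :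
    (AbsUnifOnCompacts (termPos θ ω k) ∧ AbsUnifOnCompacts (termNeg θ ω k)) ∧
    (Differentiable ℂ fun s => ∑' m, termPos θ ω k m s) ∧
    Differentiable ℂ fun s => ∑' m, termNeg θ ω k m s := by
  have hP : ∀ R : ℝ, ∃ u : ℕ+ → ℝ, Summable u ∧
      ∀ (r : ℕ+) s, ‖s‖ ≤ R → ‖termPos θ ω k r s‖ ≤ u r := by
    simp only [termPos_eq]
    exact exists_bound_residueTerm hω hρ hβ k (Or.inr rfl) fun j => by
      simpa [ratios] using him j k j.2
  have hN : ∀ R : ℝ, ∃ u : ℕ+ → ℝ, Summable u ∧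
      ∀ (r : ℕ+) s, ‖s‖ ≤ R → ‖termNeg θ ω k r s‖ ≤ u r := by
    simp only [termNeg_eq]
    exact exists_bound_residueTerm hω hρ hβ k (Or.inl rfl) fun j => by
      simpa [ratios] using him j k j.2
  exact ⟨⟨absUnifOnCompacts_of_bound hP, absUnifOnCompacts_of_bound hN⟩,
    differentiable_tsum_of_bound
      (fun r => (differentiable_tPow_sub_one _ _).mul_const _) hP,
    differentiable_tsum_of_bound
      (fun r => (differentiable_tPow_sub_one _ _).mul_const _) hN⟩

theorem funcEqRHS_eq (θ : ℝ) (ω : Fin n → ℂ) : funcEqRHS θ ω = fun s =>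
    -(2 * Real.pi * I) * ((Gamma s)⁻¹ * (exp (2 * Real.pi * I * s) - 1)⁻¹) *
    ∑ k, (ω k)⁻¹ *
      (((∑' m : ℕ+, termPos θ ω k m s) + (∑' m : ℕ+, termNeg θ ω k m s)) +
        (delta (indexNeg ω k) * tPow θ (2 * Real.pi * I * (ω k)⁻¹) (s - 1) +
        delta (indexPos ω k) * tPow θ (-2 * Real.pi * I * (ω k)⁻¹) (s - 1)) *
          riemannZeta (1 - s)) := by
  funext s
  rw [funcEqRHS, div_eq_mul_inv, mul_inv, ← neg_mul]
  refine congrArg _ (Finset.sum_congr rfl fun k _ => ?_)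
  ring

/-- The formula is an expression in entire functions, in `1 / (e ^ (2πis) - 1)` and in
`ζ(1 - s)`, so its regularity at a point follows from that of the last two. -/
theorem meromorphicAt_and_analyticAt_funcEqRHS (hω : ∀ j, ω j = ρ j * exp (β j * I))
    (hρ : ∀ j, 0 < ρ j) (hβ : ∀ j, |β j - θ| < Real.pi / 2)
    (him : ∀ j k, j ≠ k → (ω j / ω k).im ≠ 0) (s : ℂ) :
    MeromorphicAt (funcEqRHS θ ω) s ∧
      ((∀ l : ℤ, s ≠ l) → AnalyticAt ℂ (funcEqRHS θ ω) s) := by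
  have hΓ : AnalyticAt ℂ (fun s => (Gamma s)⁻¹) s := differentiable_one_div_Gamma.analyticAt s
  have hE : AnalyticAt ℂ (fun s => exp (2 * Real.pi * I * s) - 1) s := by fun_prop
  have hT : ∀ k, AnalyticAt ℂ (fun s => (∑' m : ℕ+, termPos θ ω k m s) +
      (∑' m : ℕ+, termNeg θ ω k m s)) s := fun k => by
    obtain ⟨-, h1, h2⟩ := differentiable_tsum_termPos_and_termNeg hω hρ hβ him k
    exact (h1.add h2).analyticAt s
  have hD : ∀ k, AnalyticAt ℂ (fun s =>
      delta (indexNeg ω k) * tPow θ (2 * Real.pi * I * (ω k)⁻¹) (s - 1) +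
        delta (indexPos ω k) * tPow θ (-2 * Real.pi * I * (ω k)⁻¹) (s - 1)) s := fun k =>
    (((differentiable_tPow_sub_one _ _).const_mul _).add
      ((differentiable_tPow_sub_one _ _).const_mul _)).analyticAt s
  rw [funcEqRHS_eq]
  constructor
  · have hζ : MeromorphicAt (fun s => riemannZeta (1 - s)) s :=
      (meromorphicAt_riemannZeta (1 - s)).comp_analyticAt (g := fun s => 1 - s) (by fun_prop)
    refine MeromorphicAt.mul ((MeromorphicAt.const _ s).mul (hΓ.meromorphicAt.mul
      hE.meromorphicAt.inv)) (MeromorphicAt.fun_sum fun k _ => ?_)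
    exact (MeromorphicAt.const _ s).mul
      ((hT k).meromorphicAt.add ((hD k).meromorphicAt.mul hζ))
  · intro hs
    have hE0 : exp (2 * Real.pi * I * s) - 1 ≠ 0 := by
      intro h
      obtain ⟨l, hl⟩ := exp_eq_one_iff.mp (sub_eq_zero.mp h)
      exact hs l (mul_left_cancel₀ two_pi_I_ne_zero (hl.trans (mul_comm _ _)))
    have hζ : AnalyticAt ℂ (fun s => riemannZeta (1 - s)) s := by
      have hd : DifferentiableOn ℂ (fun s => riemannZeta (1 - s)) {0}ᶜ := fun z hz =>
        ((differentiableAt_riemannZeta (by simpa using hz)).comp z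
          (by fun_prop : DifferentiableAt ℂ (fun s => 1 - s) z)).differentiableWithinAt
      exact hd.analyticAt (isOpen_compl_singleton.mem_nhds (by simpa using hs 0))
    refine AnalyticAt.mul (analyticAt_const.mul (hΓ.mul (hE.inv hE0)))
      (Finset.analyticAt_fun_sum _ fun k _ => ?_)
    exact analyticAt_const.mul ((hT k).add ((hD k).mul hζ))

end

/-- Two meromorphic functions in normal form that agree on a right half plane are equal. -/
theorem isBarnesZeta_unique {n : ℕ} {θ : ℝ} {a : ℂ} {ω : Fin n → ℂ} {Z Z' : ℂ → ℂ}
    (h : IsBarnesZeta θ a ω Z) (h' : IsBarnesZeta θ a ω Z') : Z = Z' := by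
  have hd : MeromorphicOn (Z - Z') Set.univ := h.1.meromorphicOn.sub h'.1.meromorphicOn
  have h0 : meromorphicOrderAt (Z - Z') ((n : ℂ) + 1) = ⊤ := by
    rw [meromorphicOrderAt_eq_top_iff]
    refine Filter.Eventually.filter_mono nhdsWithin_le_nhds ?_
    have hU : IsOpen {z : ℂ | (n : ℝ) < z.re} := isOpen_lt continuous_const continuous_re
    filter_upwards [hU.mem_nhds (show (n : ℂ) + 1 ∈ {z : ℂ | (n : ℝ) < z.re} by simp)] with z hz
    rw [Pi.sub_apply, (h.2 z hz).unique (h'.2 z hz), sub_self]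
  have h1 := hd.exists_meromorphicOrderAt_ne_top_iff_forall isConnected_univ
  funext x
  have h2 : meromorphicOrderAt (Z - Z') x = ⊤ := by
    by_contra h3
    exact h1.mp ⟨⟨x, trivial⟩, h3⟩ ⟨(n : ℂ) + 1, trivial⟩ h0
  have h3 : Z =ᶠ[𝓝[≠] x] Z' := by
    filter_upwards [meromorphicOrderAt_eq_top_iff.mp h2] with z hz
    exact sub_eq_zero.mp hz
  exact (((h.1 (Set.mem_univ x)).eventuallyEq_nhdsNE_iff_eventuallyEq_nhds
    (h'.1 (Set.mem_univ x))).mp h3).eq_of_nhds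

theorem eventually_nhdsNE_ne_intCast (s : ℂ) : ∀ᶠ z : ℂ in 𝓝[≠] s, ∀ l : ℤ, z ≠ l := by
  have h : AnalyticAt ℂ (fun z : ℂ => exp (2 * Real.pi * I * z) - 1) s := by fun_prop
  have hmul : ∀ z : ℂ, (∃ l : ℤ, z = l) → exp (2 * Real.pi * I * z) - 1 = 0 := by
    rintro z ⟨l, rfl⟩
    rw [mul_comm, exp_int_mul_two_pi_mul_I, sub_self]
  rcases h.eventually_eq_zero_or_eventually_ne_zero with h1 | h1
  · -- The derivative of `e ^ (2πiz) - 1` does not vanish.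
    have h2 : HasDerivAt (fun z : ℂ => exp (2 * Real.pi * I * z) - 1)
        (exp (2 * Real.pi * I * s) * (2 * Real.pi * I)) s := by
      have h3 : HasDerivAt (fun z : ℂ => 2 * Real.pi * I * z) (2 * Real.pi * I) s := by
        simpa using (hasDerivAt_id s).const_mul (2 * Real.pi * I)
      exact h3.cexp.sub_const 1
    have h3 := h2.unique ((hasDerivAt_const s (0 : ℂ)).congr_of_eventuallyEq h1)
    exact absurd h3 (mul_ne_zero (exp_ne_zero _) two_pi_I_ne_zero)
  · filter_upwards [h1] with z hz l hl
    exact hz (hmul z ⟨l, hl⟩)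

end BarnesZeta

end

theorem corollary2p2 {n : ℕ} (hn : 2 ≤ n) (θ : ℝ) (ω : Fin n → ℂ)
    (hω : ∀ j, ω j ∈ BarnesZeta.halfPlane θ)
    (him : ∀ j k, j ≠ k → (ω j / ω k).im ≠ 0) :
    -- the zeta function is the meromorphic continuation of its Dirichlet series
    BarnesZeta.IsBarnesZeta θ (BarnesZeta.aPoint ω 0) ω
      (BarnesZeta.barnesZeta θ (BarnesZeta.aPoint ω 0) ω) ∧
    -- the series on the right-hand side converge
    (∀ k, BarnesZeta.AbsUnifOnCompacts (BarnesZeta.termPos θ ω k) ∧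
      BarnesZeta.AbsUnifOnCompacts (BarnesZeta.termNeg θ ω k)) ∧
    -- the formula, at every point where all factors on the right are defined
    (∀ s : ℂ, (∀ l : ℤ, s ≠ (l : ℂ)) →
      BarnesZeta.barnesZeta θ (BarnesZeta.aPoint ω 0) ω s = BarnesZeta.funcEqRHS θ ω s) ∧
    -- the formula as an identity of meromorphic functions on the whole plane
    MeromorphicOn (BarnesZeta.funcEqRHS θ ω) Set.univ ∧
    BarnesZeta.barnesZeta θ (BarnesZeta.aPoint ω 0) ω =
      toMeromorphicNFOn (BarnesZeta.funcEqRHS θ ω) Set.univ := by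
  open BarnesZeta in
  obtain ⟨ρ, β, hω', hρ, hβ, hinj⟩ := exists_polar hω him
  have hreg := meromorphicAt_and_analyticAt_funcEqRHS hω' hρ hβ him
  have hmero : MeromorphicOn (funcEqRHS θ ω) Set.univ := fun s _ => (hreg s).1
  have hNF := meromorphicNFOn_toMeromorphicNFOn (funcEqRHS θ ω) Set.univ
  have hZ : IsBarnesZeta θ (aPoint ω 0) ω (toMeromorphicNFOn (funcEqRHS θ ω) Set.univ) := by
    refine ⟨hNF, fun s hs => ?_⟩
    obtain ⟨h1, h2⟩ := summable_and_analyticAt_dirichletTerm hn hω' hρ hβ hs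
    have hU : IsOpen {z : ℂ | (n : ℝ) < z.re} := isOpen_lt continuous_const continuous_re
    have h3 : (fun z => ∑' l, dirichletTerm θ (aPoint ω 0) ω z l) =ᶠ[𝓝[≠] s]
        toMeromorphicNFOn (funcEqRHS θ ω) Set.univ := by
      filter_upwards [hmero.toMeromorphicNFOn_eq_self_on_nhdsNE (Set.mem_univ s),
        eventually_nhdsNE_ne_intCast s, mem_nhdsWithin_of_mem_nhds (hU.mem_nhds hs)]
        with z hz hz2 hz3
      rw [hz]
      exact tsum_dirichletTerm_eq_funcEqRHS hn hω' hρ hβ hinj him hz3 hz2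
    have h4 := ((h2.meromorphicNFAt.eventuallyEq_nhdsNE_iff_eventuallyEq_nhds
      (hNF (Set.mem_univ s))).mp h3).eq_of_nhds
    rw [← h4]
    exact h1.hasSum
  have hex : ∃ Z, IsBarnesZeta θ (aPoint ω 0) ω Z := ⟨_, hZ⟩
  have hB : IsBarnesZeta θ (aPoint ω 0) ω (barnesZeta θ (aPoint ω 0) ω) := by
    rw [barnesZeta, dif_pos hex]
    exact hex.choose_spec
  have heq := isBarnesZeta_unique hB hZ
  refine ⟨hB, fun k => (differentiable_tsum_termPos_and_termNeg hω' hρ hβ him k).1,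
    fun s hs => ?_, hmero, heq⟩
  rw [heq]
  exact (((hNF (Set.mem_univ s)).eventuallyEq_nhdsNE_iff_eventuallyEq_nhds
    ((hreg s).2 hs).meromorphicNFAt).mp
      (hmero.toMeromorphicNFOn_eq_self_on_nhdsNE (Set.mem_univ s))).eq_of_nhds
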